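/- **Proposition 2.1.** Let $E=\mathbb R^d$, identify $E^*$ with $\mathbb R^d$ through the Euclidean inner product, and write $\langle X\rangle=(1+|X|^2)^{1/2}$ for $X\in E\times E^*$. Let $m:E\times E^*\to(0,\infty)$ be an order function, i.e. $m$ is Lebesgue measurable and there are $C_0,N_0>0$ with $$m(X)\le C_0\langle X-Y\rangle^{N_0}m(Y),\qquad X,Y\in E\times E^*.$$ Let $\Gamma\subset E\times E^*$ be a lattice (the $\mathbb Z$-span of a basis of $E\times E^*$), let $0\le\chi\in\mathscr S(E\times E^*)$ satisfy $\sum_{\gamma\in\Gamma}\chi(X-\gamma)=1$ for all $X$, and put $\chi_\gamma(X)=\chi(X-\gamma)$. For $b\in\mathscr S(E\times E^*)$ let $$K_b(x,y)=(2\pi)^{-d}\int e^{i\langle x-y,\theta\rangle}\,b\Big(\frac{x+y}{2},\theta\Big)\,d\theta ,$$ the kernel of the Weyl quantization $b^w$ of $b$; for $a\in\mathscr S'(E)$ the function $b^wa$ is given by pairing $a$ with a Schwartz function, $(b^wa)(x)=\langle a,K_b(x,\cdot)\rangle$. Set $$\|a\|_{\widetilde S(m)}=\sup_{\gamma\in\Gamma}\frac{1}{m(\gamma)}\|\chi_\gamma^w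 a\|_{L^2(E)}\in[0,\infty],\qquad \widetilde S(m)=\{a\in\mathscr S'(E):\ \|a\|_{\widetilde S(m)}<\infty\}.$$ Let $u\in\widetilde S(m)$. Then there exists a sequence $u_\nu\in\mathscr S(E)$, $\nu\in\mathbb N$, such that $u_\nu\to u$ in $\mathscr S'(E)$, that is, $\int u_\nu\varphi\,dx\to\langle u,\varphi\rangle$ for every $\varphi\in\mathscr S(E)$, and which is bounded in $\widetilde S(m)$: $u_\nu\in\widetilde S(m)$ for all $\nu$ and $\sup_\nu\|u_\nu\|_{\widetilde S(m)}<\infty$. -/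

import Mathlib

open MeasureTheory Filter Topology
open scoped SchwartzMap ENNReal ContDiff

namespace SymbolSpace

/-! ### Partial integrals of Schwartz functions -/

section PartialIntegral

variable {E F : Type} [NormedAddCommGroup E] [NormedSpace ℝ E]
  [NormedAddCommGroup F] [NormedSpace ℝ F]
  [MeasureSpace F] [(volume : Measure F).HasTemperateGrowth]

theorem exists_bound_partial {W : Type} [NormedAddCommGroup W] [NormedSpace ℝ W]
    (g : 𝓢(E × F, W)) (k : ℕ) :
    ∃ B : F → ℝ, Integrable B volume ∧ ∀ y t, ‖y‖ ^ k * ‖g (y, t)‖ ≤ B t := by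
  set N := (volume : Measure F).integrablePower
  refine ⟨fun t => 2 ^ (k + N) * ((Finset.Iic (k + N, 0)).sup
      (fun m => SchwartzMap.seminorm ℝ m.1 m.2) g) * (1 + ‖t‖) ^ (-(N : ℝ)), ?_, ?_⟩
  · exact (Measure.integrable_pow_neg_integrablePower (volume : Measure F)).const_mul _
  · intro y t
    have h := SchwartzMap.one_add_le_sup_seminorm_apply (𝕜 := ℝ) (m := (k + N, 0)) (k := k + N)
      (n := 0) le_rfl le_rfl g (y, t)
    rw [norm_iteratedFDeriv_zero] at h
    have hy : ‖y‖ ≤ 1 + ‖(y, t)‖ := by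
      have : ‖y‖ ≤ ‖(y, t)‖ := norm_fst_le (y, t)
      linarith
    have ht : 1 + ‖t‖ ≤ 1 + ‖(y, t)‖ := by
      have : ‖t‖ ≤ ‖(y, t)‖ := norm_snd_le (y, t)
      linarith
    have hpos : (0 : ℝ) < 1 + ‖t‖ := by positivity
    beta_reduce
    rw [Real.rpow_neg hpos.le, Real.rpow_natCast, ← div_eq_mul_inv, le_div_iff₀ (by positivity)]
    calc ‖y‖ ^ k * ‖g (y, t)‖ * (1 + ‖t‖) ^ N
        ≤ (1 + ‖(y, t)‖) ^ k * ‖g (y, t)‖ * (1 + ‖(y, t)‖) ^ N := by gcongr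
      _ = (1 + ‖(y, t)‖) ^ (k + N) * ‖g (y, t)‖ := by ring
      _ ≤ _ := h

variable [BorelSpace F] [SecondCountableTopology F]

theorem integrable_partial {W : Type} [NormedAddCommGroup W] [NormedSpace ℝ W]
    (g : 𝓢(E × F, W)) (y : E) : Integrable (fun t => g (y, t)) volume := by
  obtain ⟨B, hB, h⟩ := exists_bound_partial g 0
  refine hB.mono' (g.continuous.comp (by fun_prop)).aestronglyMeasurable (.of_forall fun t => ?_)
  simpa using h y t

/-- The derivative of a Schwartz function in its first argument. -/
noncomputable def fderivFst {W : Type} [NormedAddCommGroup W] [NormedSpace ℝ W]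
    (g : 𝓢(E × F, W)) : 𝓢(E × F, E →L[ℝ] W) :=
  SchwartzMap.postcompCLM (𝕜 := ℝ)
    ((ContinuousLinearMap.compL ℝ E (E × F) W).flip (ContinuousLinearMap.inl ℝ E F))
    (SchwartzMap.fderivCLM ℝ (E × F) W g)

theorem hasFDerivAt_partialIntegral {W : Type} [NormedAddCommGroup W] [NormedSpace ℝ W]
    (g : 𝓢(E × F, W)) (y : E) :
    HasFDerivAt (fun y => ∫ t, g (y, t)) (∫ t, fderivFst g (y, t)) y := by
  obtain ⟨B, hB, h⟩ := exists_bound_partial (fderivFst g) 0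
  refine hasFDerivAt_integral_of_dominated_of_fderiv_le (s := Set.univ) (bound := B) univ_mem
    (.of_forall fun z => (integrable_partial g z).aestronglyMeasurable) (integrable_partial g y)
    (integrable_partial (fderivFst g) y).aestronglyMeasurable
    (.of_forall fun t z _ => by simpa using h z t) hB (.of_forall fun t z _ => ?_)
  exact (g.differentiableAt (x := (z, t))).hasFDerivAt.comp z (hasFDerivAt_prodMk_left z t)

theorem contDiff_partialIntegral (n : ℕ) {W : Type} [NormedAddCommGroup W] [NormedSpace ℝ W]
    (g : 𝓢(E × F, W)) : ContDiff ℝ n (fun y => ∫ t, g (y, t)) := by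
  induction n generalizing W with
  | zero =>
    exact contDiff_zero.2 (continuous_iff_continuousAt.2 fun y =>
      (hasFDerivAt_partialIntegral g y).continuousAt)
  | succ n ih =>
    push_cast
    refine contDiff_succ_iff_fderiv.2
      ⟨fun y => (hasFDerivAt_partialIntegral g y).differentiableAt, fun h => ?_, ?_⟩
    · exact absurd h (by exact_mod_cast WithTop.coe_ne_top)
    rw [funext fun y => (hasFDerivAt_partialIntegral g y).fderiv]
    exact ih (fderivFst g)

theorem decay_partialIntegral (k n : ℕ) {W : Type} [NormedAddCommGroup W] [NormedSpace ℝ W]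
    (g : 𝓢(E × F, W)) :
    ∃ C : ℝ, ∀ y, ‖y‖ ^ k * ‖iteratedFDeriv ℝ n (fun y => ∫ t, g (y, t)) y‖ ≤ C := by
  induction n generalizing W with
  | zero =>
    obtain ⟨B, hB, h⟩ := exists_bound_partial g k
    refine ⟨∫ t, B t, fun y => ?_⟩
    rw [norm_iteratedFDeriv_zero]
    calc ‖y‖ ^ k * ‖∫ t, g (y, t)‖ ≤ ‖y‖ ^ k * ∫ t, ‖g (y, t)‖ := by
          gcongr
          exact norm_integral_le_integral_norm _
      _ = ∫ t, ‖y‖ ^ k * ‖g (y, t)‖ := (integral_const_mul _ _).symm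
      _ ≤ ∫ t, B t := integral_mono ((integrable_partial g y).norm.const_mul _) hB (h y)
  | succ n ih =>
    obtain ⟨C, hC⟩ := ih (fderivFst g)
    refine ⟨C, fun y => ?_⟩
    rw [← norm_iteratedFDeriv_fderiv,
      funext fun y => (hasFDerivAt_partialIntegral g y).fderiv]
    exact hC y

/-- The Schwartz function `y ↦ ∫ g (y, t) dt`. -/
noncomputable def partialIntegral {W : Type} [NormedAddCommGroup W] [NormedSpace ℝ W]
    (g : 𝓢(E × F, W)) : 𝓢(E, W) where
  toFun y := ∫ t, g (y, t)
  smooth' := contDiff_infty.2 fun n => contDiff_partialIntegral n g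
  decay' k n := decay_partialIntegral k n g

end PartialIntegral

theorem hasTemperateGrowth_cexp_ofReal_mul_I :
    Function.HasTemperateGrowth (fun t : ℝ => Complex.exp (t * Complex.I)) := by
  have hd : ∀ n : ℕ, iteratedDeriv n (fun t : ℝ => Complex.exp (t * Complex.I)) =
      fun t : ℝ => Complex.I ^ n * Complex.exp (t * Complex.I) := by
    intro n
    induction n with
    | zero => simp
    | succ n ih =>
      rw [iteratedDeriv_succ, ih]
      funext t
      have h1 : HasDerivAt (fun t : ℝ => (t : ℂ) * Complex.I) (1 * Complex.I) t :=
        (Complex.ofRealCLM.hasDerivAt (x := t)).mul_const Complex.I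
      rw [(h1.cexp.const_mul (Complex.I ^ n)).deriv]
      ring
  refine ⟨(Complex.ofRealCLM.contDiff.mul contDiff_const).cexp, fun n => ⟨0, 1, fun t => ?_⟩⟩
  rw [norm_iteratedFDeriv_eq_norm_iteratedDeriv, hd]
  simp [Complex.norm_exp_ofReal_mul_I]

/-! ### Weyl quantization -/

/-- `ℝ^d` with its Euclidean structure; the dual space is identified with it by `⟪·, ·⟫`. -/
abbrev Eucl (d : ℕ) : Type := EuclideanSpace ℝ (Fin d)

variable {d : ℕ}

theorem hasTemperateGrowth_phase (x : Eucl d) :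
    Function.HasTemperateGrowth
      (fun p : Eucl d × Eucl d => Complex.exp ((inner ℝ (x - p.1) p.2 : ℝ) * Complex.I)) := by
  have h : Function.HasTemperateGrowth
      (fun p : Eucl d × Eucl d => (inner ℝ (x - p.1) p.2 : ℝ)) := by
    have h1 : Function.HasTemperateGrowth (fun p : Eucl d × Eucl d => x - p.1) :=
      (Function.HasTemperateGrowth.const x).sub
        (ContinuousLinearMap.fst ℝ (Eucl d) (Eucl d)).hasTemperateGrowth
    exact (innerSL ℝ).bilinear_hasTemperateGrowth h1
      (ContinuousLinearMap.snd ℝ (Eucl d) (Eucl d)).hasTemperateGrowth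
  exact hasTemperateGrowth_cexp_ofReal_mul_I.comp h

theorem hasTemperateGrowth_midpoint (x : Eucl d) :
    Function.HasTemperateGrowth
      (fun p : Eucl d × Eucl d => ((1 / 2 : ℝ) • (x + p.1), p.2)) := by
  have h : (fun p : Eucl d × Eucl d => ((1 / 2 : ℝ) • (x + p.1), p.2)) =
      fun p => ((1 / 2 : ℝ) • x, (0 : Eucl d)) +
        (((1 / 2 : ℝ) • ContinuousLinearMap.fst ℝ (Eucl d) (Eucl d)).prod
          (ContinuousLinearMap.snd ℝ (Eucl d) (Eucl d))) p := by
    funext p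
    simp [smul_add]
  rw [h]
  exact (Function.HasTemperateGrowth.const _).add (ContinuousLinearMap.hasTemperateGrowth _)

theorem antilipschitz_midpoint (x : Eucl d) :
    AntilipschitzWith 2 (fun p : Eucl d × Eucl d => ((1 / 2 : ℝ) • (x + p.1), p.2)) := by
  refine AntilipschitzWith.of_le_mul_dist fun p q => ?_
  have h1 : dist ((1 / 2 : ℝ) • (x + p.1)) ((1 / 2 : ℝ) • (x + q.1)) = 1 / 2 * dist p.1 q.1 := by
    rw [dist_smul₀, dist_add_left]
    norm_num
  have h2 : (0 : ℝ) ≤ dist p.2 q.2 := dist_nonneg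
  rw [Prod.dist_eq, Prod.dist_eq]
  refine max_le ?_ ?_
  · have := le_max_left (dist ((1 / 2 : ℝ) • (x + p.1)) ((1 / 2 : ℝ) • (x + q.1))) (dist p.2 q.2)
    rw [h1] at this
    simp only [NNReal.coe_ofNat, h1]
    linarith
  · have := le_max_right (dist ((1 / 2 : ℝ) • (x + p.1)) ((1 / 2 : ℝ) • (x + q.1))) (dist p.2 q.2)
    simp only [NNReal.coe_ofNat]
    linarith

/-- The function `(y, θ) ↦ e^{i⟨x - y, θ⟩} b((x + y)/2, θ)` for fixed `x`, as a Schwartz function. -/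
noncomputable def weylIntegrand (b : 𝓢(Eucl d × Eucl d, ℂ)) (x : Eucl d) :
    𝓢(Eucl d × Eucl d, ℂ) :=
  SchwartzMap.smulLeftCLM ℂ
    (fun p : Eucl d × Eucl d => Complex.exp ((inner ℝ (x - p.1) p.2 : ℝ) * Complex.I))
    (SchwartzMap.compCLMOfAntilipschitz ℂ (hasTemperateGrowth_midpoint x)
      (antilipschitz_midpoint x) b)

theorem weylIntegrand_apply (b : 𝓢(Eucl d × Eucl d, ℂ)) (x y θ : Eucl d) :
    weylIntegrand b x (y, θ) =
      Complex.exp ((inner ℝ (x - y) θ : ℝ) * Complex.I) * b ((1 / 2 : ℝ) • (x + y), θ) := by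
  simp [weylIntegrand, SchwartzMap.smulLeftCLM_apply_apply (hasTemperateGrowth_phase x)]

/-- The kernel `y ↦ K(x, y)` of the Weyl quantization of a Schwartz symbol `b`, see
`weylKernel_apply` for its explicit form. -/
noncomputable def weylKernel (b : 𝓢(Eucl d × Eucl d, ℂ)) (x : Eucl d) : 𝓢(Eucl d, ℂ) :=
  (((2 * Real.pi) ^ d : ℝ) : ℂ)⁻¹ • partialIntegral (weylIntegrand b x)

/-- `K(x, y) = (2π)^{-d} ∫ e^{i⟨x - y, θ⟩} b((x + y)/2, θ) dθ`. -/
theorem weylKernel_apply (b : 𝓢(Eucl d × Eucl d, ℂ)) (x y : Eucl d) :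
    weylKernel b x y = (((2 * Real.pi) ^ d : ℝ) : ℂ)⁻¹ *
      ∫ θ, Complex.exp ((inner ℝ (x - y) θ : ℝ) * Complex.I) * b ((1 / 2 : ℝ) • (x + y), θ) := by
  simp only [← weylIntegrand_apply]
  rfl

/-- The function `b^w a` for a Schwartz symbol `b` and a tempered distribution `a`: the value at
`x` is the pairing of `a` with `K(x, ·)`. -/
noncomputable def weylApply (b : 𝓢(Eucl d × Eucl d, ℂ)) (a : 𝓢'(Eucl d, ℂ)) : Eucl d → ℂ :=
  fun x => a (weylKernel b x)

/-- On Schwartz functions `weylApply` is the usual Weyl quantization. -/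
theorem weylApply_schwartz (b : 𝓢(Eucl d × Eucl d, ℂ)) (u : 𝓢(Eucl d, ℂ)) (x : Eucl d) :
    weylApply b (SchwartzMap.toTemperedDistributionCLM (Eucl d) ℂ volume u) x =
      (((2 * Real.pi) ^ d : ℝ) : ℂ)⁻¹ * ∫ y, ∫ θ,
        Complex.exp ((inner ℝ (x - y) θ : ℝ) * Complex.I) * b ((1 / 2 : ℝ) • (x + y), θ) * u y := by
  simp only [weylApply, SchwartzMap.toTemperedDistributionCLM_apply_apply, weylKernel_apply,
    smul_eq_mul, mul_assoc, integral_const_mul]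
  simp only [← mul_assoc, integral_mul_const]

/-! ### Order functions and the symbol spaces -/

/-- Order functions on `E × E*`, `E = ℝ^d`: positive Lebesgue measurable functions with
`m(X) ≤ C₀ ⟨X - Y⟩^{N₀} m(Y)`, where `⟨(x, ξ)⟩ = (1 + |x|² + |ξ|²)^{1/2}` with Euclidean norms. -/
structure IsOrderFunction (m : Eucl d × Eucl d → ℝ) : Prop where
  pos : ∀ X, 0 < m X
  measurable : NullMeasurable m volume
  growth : ∃ C₀ N₀ : ℝ, 0 < C₀ ∧ 0 < N₀ ∧ ∀ X Y : Eucl d × Eucl d,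
    m X ≤ C₀ * Real.sqrt (1 + ‖X.1 - Y.1‖ ^ 2 + ‖X.2 - Y.2‖ ^ 2) ^ N₀ * m Y

/-- A nonnegative Schwartz function whose translates by the lattice `Γ` sum up to `1`. -/
structure IsLatticePartition (Γ : Submodule ℤ (Eucl d × Eucl d))
    (χ : 𝓢(Eucl d × Eucl d, ℝ)) : Prop where
  nonneg : ∀ X, 0 ≤ χ X
  hasSum : ∀ X, HasSum (fun γ : Γ => χ (X - (γ : Eucl d × Eucl d))) 1

/-- The translate `X ↦ χ (X - γ)`, regarded as a complex-valued Schwartz function. -/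
noncomputable def translate (χ : 𝓢(Eucl d × Eucl d, ℝ)) (γ : Eucl d × Eucl d) :
    𝓢(Eucl d × Eucl d, ℂ) :=
  SchwartzMap.postcompCLM (𝕜 := ℝ) Complex.ofRealCLM (SchwartzMap.compSubConstCLM ℝ γ χ)

theorem translate_apply (χ : 𝓢(Eucl d × Eucl d, ℝ)) (γ X : Eucl d × Eucl d) :
    translate χ γ X = ((χ (X - γ) : ℝ) : ℂ) := rfl

/-- The norm `sup_{γ ∈ Γ} ‖χ_γ^w a‖_{L²} / m(γ)`, with value `∞` outside the symbol space. -/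
noncomputable def symbolNorm (m : Eucl d × Eucl d → ℝ) (Γ : Submodule ℤ (Eucl d × Eucl d))
    (χ : 𝓢(Eucl d × Eucl d, ℝ)) (a : 𝓢'(Eucl d, ℂ)) : ℝ≥0∞ :=
  ⨆ γ : Γ, eLpNorm (weylApply (translate χ γ) a) 2 volume / ENNReal.ofReal (m γ)

/-- The symbol space `S̃(m)`, the tempered distributions of finite norm. -/
def symbolSpace (m : Eucl d × Eucl d → ℝ) (Γ : Submodule ℤ (Eucl d × Eucl d))
    (χ : 𝓢(Eucl d × Eucl d, ℝ)) : Set 𝓢'(Eucl d, ℂ) :=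
  {a | symbolNorm m Γ χ a < ⊤}

end SymbolSpace

/-! Fix a window `g` with `∫ g² = 1` and, at each phase space point Y = (y, η), the packets e^{±i⟨x,
η⟩} g(x - y). Fourier inversion gives the reproducing formula `apply_eq_integral_stft`: a tempered
distribution u is (2π)^{-d} times the superposition of the packets with coefficients Φ(Y) =
u(`dualPacket g Y`). Membership in the symbol space is traded for the pointwise bound |Φ| ≤ S m, and
u is approximated by truncated Riemann sums of this superposition.

The hard direction, `exists_norm_apply_dualPacket_le`, bounds Φ by m. Since the χ_γ sum to 1, the
transposes of χ_γ^w sum weakly to the identity. Write a dual packet at X as the sum of its images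
under these transposes. For γ within distance R of X, Cauchy-Schwarz bounds the contribution by ‖g‖
‖χ_γ^w u‖, hence by a multiple of m(γ), comparable to m(X) for fixed R. For distant γ the image has
a short-time Fourier transform decaying rapidly in both X - γ and Y - γ; the reproducing formula
bounds the whole remainder by O(1/(1 + R)) times a weighted supremum of |Φ|. This is absorbed for
large R. Absorption needs a finite supremum, supplied by the polynomial growth of Φ after adding a
small polynomial weight to m.

Conversely, `exists_symbolNorm_le` shows that |v(`dualPacket g Y`)| ≤ A m(Y) forces a symbol norm
O(A), because the kernels of χ_γ^w are localized near γ uniformly in γ. The coefficients of the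
Riemann sums are bounded by m through an almost-diagonal estimate
(`exists_norm_packetSum_dualPacket_le`), and dominated convergence gives the limit
(`tendsto_packetSum`). -/

namespace SymbolSpace

/-! ### Slices and tensor products of Schwartz functions -/

section Slice

variable {E F W : Type} [NormedAddCommGroup E] [NormedSpace ℝ E]
  [NormedAddCommGroup F] [NormedSpace ℝ F] [NormedAddCommGroup W] [NormedSpace ℝ W]

theorem iteratedFDeriv_slice {f : E × F → W} {n : ℕ} (hf : ContDiff ℝ n f) (t : F) (x : E) :
    iteratedFDeriv ℝ n (fun x => f (x, t)) x =
      (iteratedFDeriv ℝ n f (x, t)).compContinuousLinearMap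
        fun _ => ContinuousLinearMap.inl ℝ E F := by
  have h1 : (fun x => f (x, t)) =
      (fun p => f (p + (0, t))) ∘ (ContinuousLinearMap.inl ℝ E F) := by
    funext x; simp
  have h2 : ContDiff ℝ n (fun p : E × F => f (p + (0, t))) :=
    hf.comp (contDiff_id.add contDiff_const)
  rw [h1, ContinuousLinearMap.iteratedFDeriv_comp_right _ h2 x le_rfl,
    iteratedFDeriv_comp_add_right]
  simp

theorem norm_compContinuousLinearMap_inl_le {n : ℕ}
    (A : ContinuousMultilinearMap ℝ (fun _ : Fin n => E × F) W) :
    ‖A.compContinuousLinearMap fun _ => ContinuousLinearMap.inl ℝ E F‖ ≤ ‖A‖ := by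
  refine (ContinuousMultilinearMap.norm_compContinuousLinearMap_le _ _).trans ?_
  refine mul_le_of_le_one_right (norm_nonneg _) (Finset.prod_le_one (fun _ _ => norm_nonneg _) ?_)
  intro i _
  exact ContinuousLinearMap.opNorm_le_bound _ zero_le_one fun x => by simp [Prod.norm_def]

theorem norm_iteratedFDeriv_slice_le {f : E × F → W} {n : ℕ} (hf : ContDiff ℝ n f)
    (t : F) (x : E) :
    ‖iteratedFDeriv ℝ n (fun x => f (x, t)) x‖ ≤ ‖iteratedFDeriv ℝ n f (x, t)‖ := by
  rw [iteratedFDeriv_slice hf]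
  exact norm_compContinuousLinearMap_inl_le _

/-- The Schwartz function `x ↦ G (x, t)`. -/
noncomputable def slice (G : 𝓢(E × F, W)) (t : F) : 𝓢(E, W) where
  toFun x := G (x, t)
  smooth' := (G.smooth ⊤).comp (contDiff_id.prodMk contDiff_const)
  decay' k n := by
    refine ⟨SchwartzMap.seminorm ℝ k n G, fun x => ?_⟩
    refine le_trans ?_ (SchwartzMap.le_seminorm ℝ k n G (x, t))
    gcongr
    · exact norm_fst_le (x, t)
    · exact norm_iteratedFDeriv_slice_le (G.smooth n) t x

@[simp] theorem slice_apply (G : 𝓢(E × F, W)) (t : F) (x : E) : slice G t x = G (x, t) := rfl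

/-- The joint weight of order `k + N` dominates both variables: `k` powers are spent on x, and `N`
remain as decay in the parameter t, enough for integrability once `N` is large. -/
theorem norm_pow_mul_iteratedFDeriv_slice_le (G : 𝓢(E × F, W)) (t : F) (k n N : ℕ) (x : E) :
    ‖x‖ ^ k * ‖iteratedFDeriv ℝ n (slice G t) x‖ ≤
      2 ^ (k + N) * ((Finset.Iic (k + N, n)).sup
        (fun m => SchwartzMap.seminorm ℝ m.1 m.2) G) * ((1 + ‖t‖) ^ N)⁻¹ := by
  have h := SchwartzMap.one_add_le_sup_seminorm_apply (𝕜 := ℝ) (m := (k + N, n)) (k := k + N)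
    (n := n) le_rfl le_rfl G (x, t)
  have hx : ‖x‖ ≤ 1 + ‖(x, t)‖ := (norm_fst_le (x, t)).trans (by linarith)
  have ht : 1 + ‖t‖ ≤ 1 + ‖(x, t)‖ := by linarith [norm_snd_le (x, t)]
  rw [← div_eq_mul_inv, le_div_iff₀ (by positivity)]
  calc ‖x‖ ^ k * ‖iteratedFDeriv ℝ n (slice G t) x‖ * (1 + ‖t‖) ^ N
      ≤ (1 + ‖(x, t)‖) ^ k * ‖iteratedFDeriv ℝ n G (x, t)‖ * (1 + ‖(x, t)‖) ^ N := by
        gcongr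
        exact norm_iteratedFDeriv_slice_le (G.smooth n) t x
    _ = (1 + ‖(x, t)‖) ^ (k + N) * ‖iteratedFDeriv ℝ n G (x, t)‖ := by ring
    _ ≤ _ := h

theorem exists_seminorm_slice_le (𝕜 : Type) [NormedField 𝕜] [NormedSpace 𝕜 W] [SMulCommClass ℝ 𝕜 W]
    (G : 𝓢(E × F, W)) (k n N : ℕ) :
    ∃ C : ℝ, 0 ≤ C ∧ ∀ t, SchwartzMap.seminorm 𝕜 k n (slice G t) ≤ C * ((1 + ‖t‖) ^ N)⁻¹ := by
  refine ⟨2 ^ (k + N) * ((Finset.Iic (k + N, n)).sup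
        (fun m => SchwartzMap.seminorm ℝ m.1 m.2) G), by positivity, fun t => ?_⟩
  exact SchwartzMap.seminorm_le_bound 𝕜 k n _ (by positivity)
    fun x => norm_pow_mul_iteratedFDeriv_slice_le G t k n N x

/-- Mean value inequality in the parameter, at the cost of one derivative. It makes the slice depend
Lipschitz-continuously on the parameter in every seminorm. -/
theorem seminorm_slice_sub_le (𝕜 : Type) [NormedField 𝕜] [NormedSpace 𝕜 W] [SMulCommClass ℝ 𝕜 W]
    (G : 𝓢(E × F, W)) (k n : ℕ) (s t : F) :
    SchwartzMap.seminorm 𝕜 k n (slice G s - slice G t) ≤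
      SchwartzMap.seminorm ℝ k (n + 1) G * ‖s - t‖ := by
  refine SchwartzMap.seminorm_le_bound 𝕜 k n _ (by positivity) fun x => ?_
  have h0 : ∀ t, iteratedFDeriv ℝ n (slice G t) x =
      (iteratedFDeriv ℝ n G (x, t)).compContinuousLinearMap
        fun _ => ContinuousLinearMap.inl ℝ E F := fun t => iteratedFDeriv_slice (G.smooth n) t x
  have h1 : iteratedFDeriv ℝ n (⇑(slice G s - slice G t)) x =
      (iteratedFDeriv ℝ n G (x, s) - iteratedFDeriv ℝ n G (x, t)).compContinuousLinearMap
        fun _ => ContinuousLinearMap.inl ℝ E F := by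
    have : (⇑(slice G s - slice G t)) = ⇑(slice G s) - ⇑(slice G t) := by ext; simp
    rw [this, iteratedFDeriv_sub_apply ((slice G s).contDiffAt n) ((slice G t).contDiffAt n), h0, h0]
    rfl
  have hG : Differentiable ℝ (iteratedFDeriv ℝ n G) :=
    (G.smooth ⊤).differentiable_iteratedFDeriv (by exact_mod_cast WithTop.coe_lt_top n)
  have h2 : ‖x‖ ^ k * ‖iteratedFDeriv ℝ n G (x, s) - iteratedFDeriv ℝ n G (x, t)‖ ≤
      SchwartzMap.seminorm ℝ k (n + 1) G * ‖s - t‖ := by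
    have h3 : ∀ z ∈ (Set.univ : Set F), HasFDerivWithinAt
        (fun z => (‖x‖ ^ k) • iteratedFDeriv ℝ n G (x, z))
        ((‖x‖ ^ k) • (fderiv ℝ (iteratedFDeriv ℝ n G) (x, z)).comp
          (ContinuousLinearMap.inr ℝ E F)) Set.univ z := by
      intro z _
      exact (((hG (x, z)).hasFDerivAt.comp z (hasFDerivAt_prodMk_right x z)).const_smul
        (‖x‖ ^ k)).hasFDerivWithinAt
    have h4 := Convex.norm_image_sub_le_of_norm_hasFDerivWithin_le h3
      (C := SchwartzMap.seminorm ℝ k (n + 1) G) ?_ convex_univ (Set.mem_univ t) (Set.mem_univ s)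
    · rw [← smul_sub, norm_smul] at h4
      simpa using h4
    · intro z _
      rw [norm_smul]
      refine le_trans ?_ (SchwartzMap.le_seminorm ℝ k (n + 1) G (x, z))
      rw [← norm_fderiv_iteratedFDeriv, norm_pow, norm_norm]
      gcongr
      · exact norm_fst_le (x, z)
      · refine (ContinuousLinearMap.opNorm_comp_le _ _).trans
          (mul_le_of_le_one_right (norm_nonneg _) ?_)
        exact ContinuousLinearMap.opNorm_le_bound _ zero_le_one fun x => by simp [Prod.norm_def]
  refine le_trans ?_ h2
  rw [h1]
  gcongr
  exact norm_compContinuousLinearMap_inl_le _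

end Slice

section Tensor

variable {E F : Type} [NormedAddCommGroup E] [NormedSpace ℝ E]
  [NormedAddCommGroup F] [NormedSpace ℝ F]

/-- The Schwartz function `(x, y) ↦ f x * g y`. -/
noncomputable def tensor (f : 𝓢(E, ℂ)) (g : 𝓢(F, ℂ)) : 𝓢(E × F, ℂ) where
  toFun p := f p.1 * g p.2
  smooth' := ((f.smooth ⊤).comp contDiff_fst).mul ((g.smooth ⊤).comp contDiff_snd)
  decay' k n := by
    have hf : ∀ i (p : E × F), ‖iteratedFDeriv ℝ i (fun p : E × F => f p.1) p‖ ≤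
        ‖iteratedFDeriv ℝ i f p.1‖ := by
      intro i p
      have : (fun p : E × F => f p.1) = f ∘ ContinuousLinearMap.fst ℝ E F := rfl
      rw [this, ContinuousLinearMap.iteratedFDeriv_comp_right _ (f.smooth i) p le_rfl]
      refine (ContinuousMultilinearMap.norm_compContinuousLinearMap_le _ _).trans ?_
      exact mul_le_of_le_one_right (norm_nonneg _) (Finset.prod_le_one
        (fun _ _ => norm_nonneg _) fun _ _ => ContinuousLinearMap.norm_fst_le ℝ E F)
    have hg : ∀ i (p : E × F), ‖iteratedFDeriv ℝ i (fun p : E × F => g p.2) p‖ ≤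
        ‖iteratedFDeriv ℝ i g p.2‖ := by
      intro i p
      have : (fun p : E × F => g p.2) = g ∘ ContinuousLinearMap.snd ℝ E F := rfl
      rw [this, ContinuousLinearMap.iteratedFDeriv_comp_right _ (g.smooth i) p le_rfl]
      refine (ContinuousMultilinearMap.norm_compContinuousLinearMap_le _ _).trans ?_
      exact mul_le_of_le_one_right (norm_nonneg _) (Finset.prod_le_one
        (fun _ _ => norm_nonneg _) fun _ _ => ContinuousLinearMap.norm_snd_le ℝ E F)
    set A := fun i => 2 ^ k * ((Finset.Iic (k, i)).sup
      (fun m => SchwartzMap.seminorm ℝ m.1 m.2) f) with hA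
    set B := fun i => 2 ^ k * ((Finset.Iic (k, i)).sup
      (fun m => SchwartzMap.seminorm ℝ m.1 m.2) g) with hB
    refine ⟨∑ i ∈ Finset.range (n + 1), (n.choose i : ℝ) * (A i * B (n - i)), fun p => ?_⟩
    have h1 := norm_iteratedFDeriv_mul_le (𝕜 := ℝ) (N := ∞)
      ((f.smooth ⊤).comp (contDiff_fst (E := E) (F := F)))
      ((g.smooth ⊤).comp (contDiff_snd (E := E) (F := F))) p (n := n)
      (by exact_mod_cast le_top)
    calc ‖p‖ ^ k * ‖iteratedFDeriv ℝ n (fun p : E × F => f p.1 * g p.2) p‖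
        ≤ ‖p‖ ^ k * ∑ i ∈ Finset.range (n + 1), (n.choose i : ℝ) *
          ‖iteratedFDeriv ℝ i (fun p : E × F => f p.1) p‖ *
          ‖iteratedFDeriv ℝ (n - i) (fun p : E × F => g p.2) p‖ := by
          exact mul_le_mul_of_nonneg_left h1 (by positivity)
      _ = ∑ i ∈ Finset.range (n + 1), (n.choose i : ℝ) * (‖p‖ ^ k *
          (‖iteratedFDeriv ℝ i (fun p : E × F => f p.1) p‖ *
          ‖iteratedFDeriv ℝ (n - i) (fun p : E × F => g p.2) p‖)) := by
          rw [Finset.mul_sum]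
          exact Finset.sum_congr rfl fun i _ => by ring
      _ ≤ _ := by
          refine Finset.sum_le_sum fun i _ => mul_le_mul_of_nonneg_left ?_ (Nat.cast_nonneg _)
          have hf' := SchwartzMap.one_add_le_sup_seminorm_apply (𝕜 := ℝ) (m := (k, i)) (k := k)
            (n := i) le_rfl le_rfl f p.1
          have hg' := SchwartzMap.one_add_le_sup_seminorm_apply (𝕜 := ℝ) (m := (k, n - i))
            (k := k) (n := n - i) le_rfl le_rfl g p.2
          -- The joint weight is bounded by a product of weights, so each Leibniz term factors into
          -- a seminorm of `f` times one of `g`.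
          have hp : ‖p‖ ≤ (1 + ‖p.1‖) * (1 + ‖p.2‖) := by
            rw [Prod.norm_def]
            have := norm_nonneg p.1
            have := norm_nonneg p.2
            refine max_le ?_ ?_ <;> nlinarith
          calc _ ≤ ((1 + ‖p.1‖) * (1 + ‖p.2‖)) ^ k *
                (‖iteratedFDeriv ℝ i f p.1‖ * ‖iteratedFDeriv ℝ (n - i) g p.2‖) := by
                gcongr
                · exact hf i p
                · exact hg (n - i) p
            _ = ((1 + ‖p.1‖) ^ k * ‖iteratedFDeriv ℝ i f p.1‖) *
                ((1 + ‖p.2‖) ^ k * ‖iteratedFDeriv ℝ (n - i) g p.2‖) := by rw [mul_pow]; ring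
            _ ≤ A i * B (n - i) := by
                exact mul_le_mul hf' hg' (by positivity) (by positivity)

@[simp] theorem tensor_apply (f : 𝓢(E, ℂ)) (g : 𝓢(F, ℂ)) (p : E × F) :
    tensor f g p = f p.1 * g p.2 := rfl

end Tensor

/-! ### Partial Fourier transforms of Schwartz functions -/

section PartialFourier

variable {E : Type} [NormedAddCommGroup E] [NormedSpace ℝ E] {d : ℕ}
  {W : Type} [NormedAddCommGroup W] [NormedSpace ℂ W]

/-- The Schwartz function `(y, x) ↦ G (x, y)`. -/
noncomputable def swap {F W : Type} [NormedAddCommGroup F] [NormedSpace ℝ F]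
    [NormedAddCommGroup W] [NormedSpace ℝ W] (G : 𝓢(E × F, W)) : 𝓢(F × E, W) :=
  SchwartzMap.compCLMOfContinuousLinearEquiv ℝ (ContinuousLinearEquiv.prodComm ℝ F E) G

@[simp] theorem swap_apply {F W : Type} [NormedAddCommGroup F] [NormedSpace ℝ F]
    [NormedAddCommGroup W] [NormedSpace ℝ W] (G : 𝓢(E × F, W)) (p : F × E) :
    swap G p = G (p.2, p.1) := rfl

/-- The partial Fourier integral `∫ e^{i⟨y, η⟩} G (x, y) dy`. -/
noncomputable def pfIntegral (G : 𝓢(E × Eucl d, W)) (p : E × Eucl d) : W :=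
  ∫ y, Complex.exp ((inner ℝ y p.2 : ℝ) * Complex.I) • G (p.1, y)

theorem continuous_phase (η : Eucl d) :
    Continuous fun y : Eucl d => Complex.exp ((inner ℝ y η : ℝ) * Complex.I) := by
  fun_prop

theorem norm_phase_smul (t : ℝ) (w : W) : ‖Complex.exp (t * Complex.I) • w‖ = ‖w‖ := by
  rw [norm_smul, Complex.norm_exp_ofReal_mul_I, one_mul]

theorem integrable_pfIntegrand (G : 𝓢(E × Eucl d, W)) (p : E × Eucl d) :
    Integrable fun y => Complex.exp ((inner ℝ y p.2 : ℝ) * Complex.I) • G (p.1, y) := by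
  refine (integrable_partial G p.1).mono
    ((continuous_phase p.2).smul (G.continuous.comp (by fun_prop))).aestronglyMeasurable
    (.of_forall fun y => (norm_phase_smul _ _).le)

/-- The Schwartz function whose partial Fourier transform is the derivative of that of `G`. -/
noncomputable def pfDeriv (G : 𝓢(E × Eucl d, W)) : 𝓢(E × Eucl d, (E × Eucl d) →L[ℝ] W) :=
  SchwartzMap.postcompCLM (𝕜 := ℝ)
    ((ContinuousLinearMap.compL ℝ (E × Eucl d) E W).flip (ContinuousLinearMap.fst ℝ E (Eucl d)))
    (fderivFst G) +
  Complex.I • SchwartzMap.smulRightCLM ℝ W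
    (((innerSL ℝ).comp (ContinuousLinearMap.snd ℝ E (Eucl d))).bilinearComp
      (ContinuousLinearMap.id ℝ _) (ContinuousLinearMap.snd ℝ E (Eucl d))) G

theorem pfDeriv_apply (G : 𝓢(E × Eucl d, W)) (p : E × Eucl d) (v : E × Eucl d) :
    pfDeriv G p v = fderiv ℝ G p (v.1, 0) +
      Complex.I • ((inner ℝ p.2 v.2 : ℝ) • G p) := rfl

/-- Differentiation under the integral: x-derivatives fall on `G`, η-derivatives multiply by iy. The
derivative is again a partial Fourier integral of a Schwartz function, so smoothness and decay
follow by induction over all target spaces at once. -/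
theorem hasFDerivAt_pfIntegral (G : 𝓢(E × Eucl d, W)) (p : E × Eucl d) :
    HasFDerivAt (pfIntegral G) (pfIntegral (E := E) (pfDeriv G) p) p := by
  obtain ⟨B, hB, h⟩ := exists_bound_partial (pfDeriv G) 0
  refine hasFDerivAt_integral_of_dominated_of_fderiv_le (s := Set.univ) (bound := B)
    (F := fun (p : E × Eucl d) y =>
      Complex.exp ((inner ℝ y p.2 : ℝ) * Complex.I) • G (p.1, y))
    (F' := fun (p : E × Eucl d) y =>
      Complex.exp ((inner ℝ y p.2 : ℝ) * Complex.I) • pfDeriv G (p.1, y)) univ_mem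
    (.of_forall fun q => (integrable_pfIntegrand G q).aestronglyMeasurable)
    (integrable_pfIntegrand G p) (integrable_pfIntegrand (pfDeriv G) p).aestronglyMeasurable
    (.of_forall fun y q _ => ?_) hB (.of_forall fun y q _ => ?_)
  · refine (norm_phase_smul (inner ℝ y q.2) (pfDeriv G (q.1, y))).trans_le ?_
    simpa using h q.1 y
  · have h1 : HasFDerivAt (fun q : E × Eucl d => ((inner ℝ y q.2 : ℝ) : ℂ) * Complex.I)
        (((Complex.ofRealCLM.comp ((innerSL ℝ y).comp (ContinuousLinearMap.snd ℝ E (Eucl d)))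
          ).smulRight Complex.I)) q := by
      have := (Complex.ofRealCLM.comp ((innerSL ℝ y).comp
        (ContinuousLinearMap.snd ℝ E (Eucl d)))).hasFDerivAt (x := q)
      exact this.mul_const Complex.I |>.congr_fderiv (by ext v <;> simp [mul_comm])
    have h2 : HasFDerivAt (fun q : E × Eucl d => G (q.1, y))
        ((fderiv ℝ G (q.1, y)).comp ((ContinuousLinearMap.inl ℝ E (Eucl d)).comp
          (ContinuousLinearMap.fst ℝ E (Eucl d)))) q := by
      have h3 : HasFDerivAt (fun q : E × Eucl d => (q.1, y))
          ((ContinuousLinearMap.inl ℝ E (Eucl d)).comp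
          (ContinuousLinearMap.fst ℝ E (Eucl d))) q :=
        (hasFDerivAt_fst.prodMk (hasFDerivAt_const y q)).congr_fderiv (by ext <;> simp)
      exact (G.differentiableAt (x := (q.1, y))).hasFDerivAt.comp q h3
    refine (h1.cexp.smul h2).congr_fderiv ?_
    ext v
    · simp [pfDeriv_apply]
    · have hsm : ∀ (r : ℝ) (w : W), r • w = (r : ℂ) • w := fun r w => (Complex.coe_smul r w).symm
      have h4 := pfDeriv_apply G (q.1, y) (0, v)
      simp [h4]
      rw [hsm, smul_smul, smul_smul]
      congr 1
      ring

theorem contDiff_pfIntegral (n : ℕ) {W : Type} [NormedAddCommGroup W] [NormedSpace ℂ W]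
    (G : 𝓢(E × Eucl d, W)) : ContDiff ℝ n (pfIntegral G) := by
  induction n generalizing W with
  | zero =>
    exact contDiff_zero.2 (continuous_iff_continuousAt.2 fun y =>
      (hasFDerivAt_pfIntegral G y).continuousAt)
  | succ n ih =>
    push_cast
    refine contDiff_succ_iff_fderiv.2
      ⟨fun y => (hasFDerivAt_pfIntegral G y).differentiableAt, fun h => ?_, ?_⟩
    · exact absurd h (by exact_mod_cast WithTop.coe_ne_top)
    rw [funext fun y => (hasFDerivAt_pfIntegral G y).fderiv]
    exact ih (pfDeriv G)

/-- Continuity of the Fourier transform, with seminorms and constant independent of the function, so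
that it applies uniformly to a family of slices. -/
theorem exists_seminorm_fourier_le (k : ℕ) : ∃ (s : Finset (ℕ × ℕ)) (C : ℝ), 0 ≤ C ∧
    ∀ (f : 𝓢(Eucl d, W)) (D : ℝ), 0 ≤ D → (∀ i ∈ s, SchwartzMap.seminorm ℂ i.1 i.2 f ≤ D) →
      SchwartzMap.seminorm ℂ k 0 (SchwartzMap.fourierTransformCLM ℂ f) ≤ C * D := by
  have hq : Continuous ((SchwartzMap.seminorm ℂ k 0 : Seminorm ℂ 𝓢(Eucl d, W)).comp
      (SchwartzMap.fourierTransformCLM ℂ : 𝓢(Eucl d, W) →L[ℂ] 𝓢(Eucl d, W)).toLinearMap) :=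
    ((schwartz_withSeminorms ℂ (Eucl d) W).continuous_seminorm (k, 0)).comp
      (SchwartzMap.fourierTransformCLM ℂ).continuous
  obtain ⟨s, C, -, h⟩ := Seminorm.bound_of_continuous
    (schwartz_withSeminorms ℂ (Eucl d) W) _ hq
  refine ⟨s, C, C.2, fun f D hD hf => (h f).trans ?_⟩
  exact mul_le_mul_of_nonneg_left (Seminorm.finset_sup_apply_le hD hf) C.2

theorem exists_bound_pfIntegral_snd (G : 𝓢(E × Eucl d, W)) (k : ℕ) :
    ∃ C : ℝ, ∀ p, ‖p.2‖ ^ k * ‖pfIntegral G p‖ ≤ C := by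
  obtain ⟨s, C, hC, h⟩ := exists_seminorm_fourier_le (W := W) (d := d) k
  have h1 : ∀ i : ℕ × ℕ, ∃ D : ℝ, 0 ≤ D ∧
      ∀ x, SchwartzMap.seminorm ℂ i.1 i.2 (slice (swap G) x) ≤ D := by
    intro i
    obtain ⟨D, hD0, hD⟩ := exists_seminorm_slice_le ℂ (swap G) i.1 i.2 0
    exact ⟨D, hD0, fun x => by simpa using hD x⟩
  choose D hD0 hD using h1
  refine ⟨(2 * Real.pi) ^ k * (C * ∑ i ∈ s, D i), fun p => ?_⟩
  -- The Fourier transform here has phase e^{-2πi⟨y, ξ⟩}; evaluating at ξ = -η/(2π) gives e^{i⟨y,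
  -- η⟩}.
  have h2 : pfIntegral G p = SchwartzMap.fourierTransformCLM ℂ (slice (swap G) p.1)
      (-(2 * Real.pi)⁻¹ • p.2) := by
    rw [SchwartzMap.fourierTransformCLM_apply, SchwartzMap.fourier_coe, Real.fourier_eq']
    refine integral_congr_ae (.of_forall fun y => ?_)
    have : (-2 * Real.pi * inner ℝ y (-(2 * Real.pi)⁻¹ • p.2) : ℝ) = inner ℝ y p.2 := by
      rw [inner_smul_right]
      field_simp
    simp only [slice_apply, swap_apply, this]
  have h3 := SchwartzMap.le_seminorm ℂ k 0
    (SchwartzMap.fourierTransformCLM ℂ (slice (swap G) p.1)) (-(2 * Real.pi)⁻¹ • p.2)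
  rw [norm_iteratedFDeriv_zero, ← h2, norm_smul, norm_neg, norm_inv, mul_pow,
    Real.norm_of_nonneg (by positivity), inv_pow, mul_assoc, inv_mul_le_iff₀ (by positivity)] at h3
  refine h3.trans (mul_le_mul_of_nonneg_left (h _ _ (Finset.sum_nonneg fun i _ => hD0 i)
    fun i hi => (hD i p.1).trans ?_) (by positivity))
  exact Finset.single_le_sum (fun i _ => hD0 i) hi

theorem exists_bound_pfIntegral (G : 𝓢(E × Eucl d, W)) (k : ℕ) :
    ∃ C : ℝ, ∀ p, ‖p‖ ^ k * ‖pfIntegral G p‖ ≤ C := by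
  obtain ⟨C, hC⟩ := exists_bound_pfIntegral_snd G k
  obtain ⟨B, hB, h⟩ := exists_bound_partial G k
  refine ⟨max (∫ t, B t) C, fun p => ?_⟩
  rw [Prod.norm_def]
  rcases max_choice ‖p.1‖ ‖p.2‖ with h1 | h1
  · rw [h1]
    refine le_max_of_le_left ?_
    calc ‖p.1‖ ^ k * ‖pfIntegral G p‖ ≤ ‖p.1‖ ^ k * ∫ t, ‖G (p.1, t)‖ := by
          gcongr
          refine (norm_integral_le_integral_norm _).trans_eq ?_
          simp only [norm_phase_smul]
      _ = ∫ t, ‖p.1‖ ^ k * ‖G (p.1, t)‖ := (integral_const_mul _ _).symm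
      _ ≤ ∫ t, B t := integral_mono ((integrable_partial G p.1).norm.const_mul _) hB (h p.1)
  · rw [h1]
    exact le_max_of_le_right (hC p)

theorem decay_pfIntegral (k n : ℕ) {W : Type} [NormedAddCommGroup W] [NormedSpace ℂ W]
    (G : 𝓢(E × Eucl d, W)) :
    ∃ C : ℝ, ∀ p, ‖p‖ ^ k * ‖iteratedFDeriv ℝ n (pfIntegral G) p‖ ≤ C := by
  induction n generalizing W with
  | zero => simpa using exists_bound_pfIntegral G k
  | succ n ih =>
    obtain ⟨C, hC⟩ := ih (pfDeriv G)
    refine ⟨C, fun y => ?_⟩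
    rw [← norm_iteratedFDeriv_fderiv, funext fun y => (hasFDerivAt_pfIntegral G y).fderiv]
    exact hC y

/-- The partial Fourier transform `(x, η) ↦ ∫ e^{i⟨y, η⟩} G (x, y) dy` of a Schwartz function. -/
noncomputable def partialFourier (G : 𝓢(E × Eucl d, W)) : 𝓢(E × Eucl d, W) where
  toFun := pfIntegral G
  smooth' := contDiff_infty.2 fun n => contDiff_pfIntegral n G
  decay' k n := decay_pfIntegral k n G

theorem partialFourier_apply (G : 𝓢(E × Eucl d, W)) (p : E × Eucl d) :
    partialFourier G p =
      ∫ y, Complex.exp ((inner ℝ y p.2 : ℝ) * Complex.I) • G (p.1, y) := rfl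

end PartialFourier
/-! ### Pairing tempered distributions with partial integrals -/

section Pairing

variable {E F : Type} [NormedAddCommGroup E] [NormedSpace ℝ E]
  [NormedAddCommGroup F] [NormedSpace ℝ F]

theorem fderivFst_slice {W : Type} [NormedAddCommGroup W] [NormedSpace ℝ W]
    (G : 𝓢(E × F, W)) (t : F) (x : E) : fderiv ℝ (slice G t) x = slice (fderivFst G) t x := by
  have h : HasFDerivAt (fun x => G (x, t)) (slice (fderivFst G) t x) x :=
    (G.differentiableAt (x := (x, t))).hasFDerivAt.comp x (hasFDerivAt_prodMk_left x t)
  exact h.fderiv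

theorem exists_seminorm_bound (u : 𝓢'(E, ℂ)) : ∃ (s : Finset (ℕ × ℕ)) (C : ℝ), 0 ≤ C ∧
    ∀ (f : 𝓢(E, ℂ)) (D : ℝ), 0 ≤ D → (∀ i ∈ s, SchwartzMap.seminorm ℂ i.1 i.2 f ≤ D) →
      ‖u f‖ ≤ C * D := by
  have hq : Continuous ((normSeminorm ℂ ℂ).comp (u : 𝓢(E, ℂ) →ₗ[ℂ] ℂ)) :=
    continuous_norm.comp (map_continuous u)
  obtain ⟨s, C, -, h⟩ := Seminorm.bound_of_continuous (schwartz_withSeminorms ℂ E ℂ) _ hq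
  refine ⟨s, C, C.2, fun f D hD hf => (h f).trans ?_⟩
  exact mul_le_mul_of_nonneg_left (Seminorm.finset_sup_apply_le hD hf) C.2

/-- The bound lets `u` descend to a bounded functional on the range of `J`; Hahn-Banach extends it
to all of `B`. -/
theorem exists_extension_of_bound {V B : Type} [AddCommGroup V] [Module ℂ V]
    [NormedAddCommGroup B] [NormedSpace ℂ B] (J : V →ₗ[ℂ] B) (u : V →ₗ[ℂ] ℂ) {C : ℝ}
    (hb : ∀ f, ‖u f‖ ≤ C * ‖J f‖) : ∃ U : B →L[ℂ] ℂ, ∀ f, U (J f) = u f := by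
  have hker : LinearMap.ker J ≤ LinearMap.ker u := by
    intro f hf
    have := hb f
    rw [LinearMap.mem_ker.1 hf, norm_zero, mul_zero, norm_le_zero_iff] at this
    exact this
  set φ : LinearMap.range J →ₗ[ℂ] ℂ :=
    ((LinearMap.ker J).liftQ u hker).comp J.quotKerEquivRange.symm.toLinearMap with hφ
  have hφu : ∀ f, φ ⟨J f, LinearMap.mem_range_self _ f⟩ = u f := by
    intro f
    have : J.quotKerEquivRange.symm ⟨J f, LinearMap.mem_range_self _ f⟩ =
        Submodule.Quotient.mk f := by
      rw [LinearEquiv.symm_apply_eq]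
      rfl
    rw [hφ, LinearMap.comp_apply, LinearEquiv.coe_coe, this]
    rfl
  obtain ⟨U, hU, -⟩ := exists_extension_norm_eq (LinearMap.range J)
    (φ.mkContinuous C (by
      rintro ⟨_, f, rfl⟩
      rw [hφu]
      exact hb f))
  exact ⟨U, fun f => (hU ⟨_, LinearMap.mem_range_self _ f⟩).trans (hφu f)⟩

theorem continuous_apply_slice (u : 𝓢'(E, ℂ)) (G : 𝓢(E × F, ℂ)) :
    Continuous fun t => u (slice G t) := by
  obtain ⟨s, A, hA, h⟩ := exists_seminorm_bound u
  have h0 : 0 ≤ ∑ i ∈ s, SchwartzMap.seminorm ℝ i.1 (i.2 + 1) G :=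
    Finset.sum_nonneg fun i _ => apply_nonneg _ _
  refine (LipschitzWith.of_dist_le_mul (K := Real.toNNReal
    (A * ∑ i ∈ s, SchwartzMap.seminorm ℝ i.1 (i.2 + 1) G)) fun t t' => ?_).continuous
  rw [dist_eq_norm, dist_eq_norm, ← map_sub, Real.coe_toNNReal _ (by positivity), mul_assoc]
  refine h _ _ (by positivity) fun i hi => (seminorm_slice_sub_le ℂ G i.1 i.2 t t').trans ?_
  exact mul_le_mul_of_nonneg_right (Finset.single_le_sum
    (f := fun i : ℕ × ℕ => SchwartzMap.seminorm ℝ i.1 (i.2 + 1) G)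
    (fun i _ => apply_nonneg _ _) hi) (norm_nonneg _)

theorem integrable_inv_one_add_norm_pow (F : Type) [NormedAddCommGroup F] [MeasureSpace F]
    [(volume : Measure F).HasTemperateGrowth] :
    Integrable (fun t : F => ((1 + ‖t‖) ^ (volume : Measure F).integrablePower)⁻¹) := by
  refine (Measure.integrable_pow_neg_integrablePower (volume : Measure F)).congr
    (.of_forall fun t => ?_)
  have hpos : (0 : ℝ) ≤ 1 + ‖t‖ := by positivity
  simp only [Real.rpow_neg hpos, Real.rpow_natCast]

variable [MeasureSpace F] [(volume : Measure F).HasTemperateGrowth] [BorelSpace F]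
  [SecondCountableTopology F]

theorem integral_linearIsometryEquiv_comp {T A B : Type} [MeasureSpace T]
    [NormedAddCommGroup A] [NormedSpace ℝ A] [NormedAddCommGroup B] [NormedSpace ℝ B] (e : A ≃ₗᵢ[ℝ] B) {f : T → A} {g : T → B}
    (hf : Integrable f) (h : ∀ t, g t = e (f t)) : Integrable g ∧ e (∫ t, f t) = ∫ t, g t := by
  rw [funext h]
  exact ⟨e.toContinuousLinearEquiv.toContinuousLinearMap.integrable_comp hf,
    (e.toContinuousLinearEquiv.integral_comp_comm f).symm⟩

/-- Induction through the currying isometries, which commute with Bochner integrals; each step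
replaces `G` by `fderivFst G`. -/
theorem iteratedFDeriv_partialIntegral (n : ℕ) {W : Type} [NormedAddCommGroup W] [NormedSpace ℝ W]
    (G : 𝓢(E × F, W)) (x : E) :
    Integrable (fun t => iteratedFDeriv ℝ n (slice G t) x) ∧
    iteratedFDeriv ℝ n (partialIntegral G) x = ∫ t, iteratedFDeriv ℝ n (slice G t) x := by
  induction n generalizing W with
  | zero =>
    exact integral_linearIsometryEquiv_comp (continuousMultilinearCurryFin0 ℝ E W).symm
      (integrable_partial G x) fun t => rfl
  | succ n ih =>
    obtain ⟨h1, h2⟩ := ih (fderivFst G)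
    have h3 : ∀ t, iteratedFDeriv ℝ (n + 1) (slice G t) x =
        (continuousMultilinearCurryRightEquiv' ℝ n E W).symm
          (iteratedFDeriv ℝ n (slice (fderivFst G) t) x) := by
      intro t
      rw [iteratedFDeriv_succ_eq_comp_right, funext (fderivFst_slice G t)]
      rfl
    have h4 : iteratedFDeriv ℝ (n + 1) (partialIntegral G) x =
        (continuousMultilinearCurryRightEquiv' ℝ n E W).symm
          (iteratedFDeriv ℝ n (partialIntegral (fderivFst G)) x) := by
      rw [iteratedFDeriv_succ_eq_comp_right]
      have : (fun y => fderiv ℝ (partialIntegral G) y) = partialIntegral (fderivFst G) :=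
        funext fun y => (hasFDerivAt_partialIntegral G y).fderiv
      rw [this]
      rfl
    rw [h4, h2]
    exact integral_linearIsometryEquiv_comp _ h1 h3

/-- Mapping f to ‖x‖^k D f embeds one Schwartz seminorm isometrically into a Banach space of bounded
continuous functions. There the slices form a Lipschitz family with integrable decay, hence a
Bochner integrable one, and point evaluations identify its integral. -/
theorem exists_linearMap_of_derivation {M : Type} [NormedAddCommGroup M] [NormedSpace ℝ M]
    [NormedSpace ℂ M] [SMulCommClass ℝ ℂ M] [CompleteSpace M] (D : 𝓢(E, ℂ) →ₗ[ℂ] (E → M))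
    (k n : ℕ) (hc : ∀ f, Continuous (D f)) (hn : ∀ f x, ‖D f x‖ = ‖iteratedFDeriv ℝ n f x‖)
    (hD : ∀ (G : 𝓢(E × F, ℂ)) x, D (partialIntegral G) x = ∫ t, D (slice G t) x) :
    ∃ J : 𝓢(E, ℂ) →ₗ[ℂ] BoundedContinuousFunction E M,
      (∀ f, SchwartzMap.seminorm ℂ k n f ≤ ‖J f‖) ∧
      ∀ G : 𝓢(E × F, ℂ), Integrable (fun t => J (slice G t)) ∧
        J (partialIntegral G) = ∫ t, J (slice G t) := by
  set J : 𝓢(E, ℂ) →ₗ[ℂ] BoundedContinuousFunction E M :=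
    { toFun := fun f => BoundedContinuousFunction.ofNormedAddCommGroup
        (fun x => ‖x‖ ^ k • D f x) ((continuous_norm.pow _).smul (hc f))
        (SchwartzMap.seminorm ℝ k n f) fun x => by
          rw [norm_smul, norm_pow, norm_norm, hn]
          exact SchwartzMap.le_seminorm ℝ _ _ f x
      map_add' := fun f g => by
        ext x
        simp
      map_smul' := fun c f => by
        ext x
        have : D (c • f) x = c • D f x := by rw [map_smul]; rfl
        change ‖x‖ ^ k • D (c • f) x = c • ‖x‖ ^ k • D f x
        rw [this, smul_comm] } with hJ
  have hJx : ∀ f x, J f x = ‖x‖ ^ k • D f x := fun f x => rfl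
  have hnorm : ∀ f, ‖J f‖ = SchwartzMap.seminorm ℂ k n f := by
    intro f
    refine le_antisymm ((BoundedContinuousFunction.norm_le (apply_nonneg _ _)).2 fun x => ?_)
      (SchwartzMap.seminorm_le_bound ℂ _ _ _ (norm_nonneg (J f)) fun x => ?_)
    · rw [hJx, norm_smul, norm_pow, norm_norm, hn]
      exact SchwartzMap.le_seminorm ℂ _ _ f x
    · have h := (J f).norm_coe_le_norm x
      rwa [hJx, norm_smul, norm_pow, norm_norm, hn] at h
  have hint : ∀ G : 𝓢(E × F, ℂ), Integrable (fun t => J (slice G t)) := by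
    intro G
    obtain ⟨C, -, h⟩ :=
      exists_seminorm_slice_le ℂ G k n (volume : Measure F).integrablePower
    have hcont : Continuous fun t => J (slice G t) := by
      refine (LipschitzWith.of_dist_le_mul (K := Real.toNNReal
        (SchwartzMap.seminorm ℝ k (n + 1) G)) fun t t' => ?_).continuous
      rw [dist_eq_norm, dist_eq_norm, ← map_sub, Real.coe_toNNReal _ (apply_nonneg _ _), hnorm]
      exact seminorm_slice_sub_le ℂ G k n t t'
    refine ((integrable_inv_one_add_norm_pow F).const_mul C).mono' hcont.aestronglyMeasurable
      (.of_forall fun t => ?_)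
    rw [hnorm]
    exact h t
  refine ⟨J, fun f => (hnorm f).ge, fun G => ⟨hint G, ?_⟩⟩
  ext x
  have h1 := (BoundedContinuousFunction.evalCLM ℝ x).integral_comp_comm (hint G)
  refine Eq.trans ?_ h1
  simp only [BoundedContinuousFunction.evalCLM_apply, hJx, hD]
  rw [integral_smul]

theorem exists_linearMap_weightedDeriv (k n : ℕ) :
    ∃ J : 𝓢(E, ℂ) →ₗ[ℂ] @BoundedContinuousFunction E (E [×n]→L[ℝ] ℂ) _
        NormedAddCommGroup.toSeminormedAddCommGroup.toPseudoMetricSpace,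
      (∀ f, SchwartzMap.seminorm ℂ k n f ≤ ‖J f‖) ∧
      ∀ G : 𝓢(E × F, ℂ), Integrable (fun t => J (slice G t)) ∧
        J (partialIntegral G) = ∫ t, J (slice G t) :=
  exists_linearMap_of_derivation
    { toFun := fun f => iteratedFDeriv ℝ n f
      map_add' := fun f g => by
        funext x
        exact iteratedFDeriv_add_apply (f.contDiffAt n) (g.contDiffAt n)
      map_smul' := fun c f => by
        funext x
        exact iteratedFDeriv_const_smul_apply (f.contDiffAt n) }
    k n (fun f => (f.smooth n).continuous_iteratedFDeriv le_rfl) (fun f x => rfl)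
    fun G x => (iteratedFDeriv_partialIntegral n G x).2

/-- The product of the spaces for single seminorms: its maximum norm dominates every seminorm in
`s`. -/
theorem exists_linearMap_of_finset (E F : Type) [NormedAddCommGroup E] [NormedSpace ℝ E]
    [NormedAddCommGroup F] [NormedSpace ℝ F] [MeasureSpace F]
    [(volume : Measure F).HasTemperateGrowth] [BorelSpace F] [SecondCountableTopology F]
    (s : Finset (ℕ × ℕ)) :
    ∃ (B : Type) (_ : NormedAddCommGroup B) (_ : NormedSpace ℝ B) (_ : NormedSpace ℂ B)
      (_ : CompleteSpace B) (J : 𝓢(E, ℂ) →ₗ[ℂ] B),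
      (∀ f, ∀ i ∈ s, SchwartzMap.seminorm ℂ i.1 i.2 f ≤ ‖J f‖) ∧
      ∀ G : 𝓢(E × F, ℂ), Integrable (fun t => J (slice G t)) ∧
        J (partialIntegral G) = ∫ t, J (slice G t) := by
  classical
  induction s using Finset.induction_on with
  | empty => exact ⟨ℂ, inferInstance, inferInstance, inferInstance, inferInstance, 0, by simp⟩
  | insert i s _ ih =>
    obtain ⟨B, _, _, _, _, J, h1, h2⟩ := ih
    obtain ⟨J', h3, h4⟩ := exists_linearMap_weightedDeriv (E := E) (F := F) i.1 i.2
    refine ⟨_ × B, inferInstance, inferInstance, inferInstance, inferInstance, J'.prod J,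
      fun f j hj => ?_, fun G => ?_⟩
    · rcases Finset.mem_insert.1 hj with rfl | hj
      · exact (h3 f).trans (norm_fst_le (J' f, J f))
      · exact (h1 f j hj).trans (norm_snd_le (J' f, J f))
    · refine ⟨(h4 G).1.prodMk (h2 G).1, ?_⟩
      refine Eq.trans ?_ (integral_pair (h4 G).1 (h2 G).1).symm
      rw [← (h4 G).2, ← (h2 G).2]
      rfl

/-- A distribution is controlled by finitely many seminorms, so it factors as a bounded functional
through a Banach space in which the slices are Bochner integrable. Bounded functionals commute with
the integral. -/
theorem apply_partialIntegral (u : 𝓢'(E, ℂ)) (G : 𝓢(E × F, ℂ)) :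
    u (partialIntegral G) = ∫ t, u (slice G t) := by
  obtain ⟨s, A, hA, h⟩ := exists_seminorm_bound u
  obtain ⟨B, _, _, _, _, J, h1, h2⟩ := exists_linearMap_of_finset E F s
  obtain ⟨U, hU⟩ := exists_extension_of_bound J (u : 𝓢(E, ℂ) →ₗ[ℂ] ℂ) (C := A)
    fun f => h f _ (norm_nonneg _) (h1 f)
  have hU' : ∀ f, u f = U (J f) := fun f => (hU f).symm
  simp only [hU']
  rw [(h2 G).2, U.integral_comp_comm (h2 G).1]

end Pairing

/-! ### Wave packets and the short-time Fourier transform -/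

section Packets

variable {d : ℕ}

theorem hasTemperateGrowth_cexp_inner {D : Type} [NormedAddCommGroup D] [NormedSpace ℝ D]
    (A B : D →L[ℝ] Eucl d) : Function.HasTemperateGrowth
      (fun p : D => Complex.exp ((inner ℝ (A p) (B p) : ℝ) * Complex.I)) := by
  have h : Function.HasTemperateGrowth (fun p : D => (inner ℝ (A p) (B p) : ℝ)) :=
    (innerSL ℝ).bilinear_hasTemperateGrowth A.hasTemperateGrowth B.hasTemperateGrowth
  exact hasTemperateGrowth_cexp_ofReal_mul_I.comp h

theorem hasTemperateGrowth_phase_left (η : Eucl d) : Function.HasTemperateGrowth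
    (fun x : Eucl d => Complex.exp ((inner ℝ x η : ℝ) * Complex.I)) := by
  have h : Function.HasTemperateGrowth (fun x : Eucl d => (inner ℝ x η : ℝ)) :=
    ((innerSL ℝ).flip η).hasTemperateGrowth
  exact hasTemperateGrowth_cexp_ofReal_mul_I.comp h

/-- The wave packet `x ↦ e^{i⟨x, η⟩} g (x - y)` at `(y, η)`. -/
noncomputable def packet (g : 𝓢(Eucl d, ℂ)) (Y : Eucl d × Eucl d) : 𝓢(Eucl d, ℂ) :=
  SchwartzMap.smulLeftCLM ℂ (fun x => Complex.exp ((inner ℝ x Y.2 : ℝ) * Complex.I))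
    (SchwartzMap.compSubConstCLM ℂ Y.1 g)

theorem packet_apply (g : 𝓢(Eucl d, ℂ)) (Y : Eucl d × Eucl d) (x : Eucl d) :
    packet g Y x = Complex.exp ((inner ℝ x Y.2 : ℝ) * Complex.I) * g (x - Y.1) := by
  simp [packet, SchwartzMap.smulLeftCLM_apply_apply (hasTemperateGrowth_phase_left Y.2)]

/-- The wave packet `x ↦ e^{-i⟨x, η⟩} g (x - y)` conjugate to `packet g (y, η)`. -/
noncomputable def dualPacket (g : 𝓢(Eucl d, ℂ)) (Y : Eucl d × Eucl d) : 𝓢(Eucl d, ℂ) :=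
  packet g (Y.1, -Y.2)

theorem dualPacket_apply (g : 𝓢(Eucl d, ℂ)) (Y : Eucl d × Eucl d) (x : Eucl d) :
    dualPacket g Y x = Complex.exp ((-inner ℝ x Y.2 : ℝ) * Complex.I) * g (x - Y.1) := by
  simp [dualPacket, packet_apply]

theorem norm_packet_apply (g : 𝓢(Eucl d, ℂ)) (Y : Eucl d × Eucl d) (x : Eucl d) :
    ‖packet g Y x‖ = ‖g (x - Y.1)‖ := by
  rw [packet_apply, norm_mul, Complex.norm_exp_ofReal_mul_I, one_mul]

/-- The linear change of variables `(y, x) ↦ (x, x - y)`. -/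
noncomputable def shearEquiv (d : ℕ) : (Eucl d × Eucl d) ≃L[ℝ] Eucl d × Eucl d where
  toFun p := (p.2, p.2 - p.1)
  invFun p := (p.1 - p.2, p.1)
  map_add' p q := by simp [add_sub_add_comm]
  map_smul' c p := by simp [smul_sub]
  left_inv p := by simp
  right_inv p := by simp
  continuous_toFun := by fun_prop
  continuous_invFun := by fun_prop

@[simp] theorem shearEquiv_apply (p : Eucl d × Eucl d) : shearEquiv d p = (p.2, p.2 - p.1) := rfl

/-- The short-time Fourier transform `(y, η) ↦ ∫ e^{i⟨x, η⟩} g (x - y) f x dx`. -/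
noncomputable def stft (g f : 𝓢(Eucl d, ℂ)) : 𝓢(Eucl d × Eucl d, ℂ) :=
  partialFourier (SchwartzMap.compCLMOfContinuousLinearEquiv ℂ (shearEquiv d) (tensor f g))

theorem stft_apply (g f : 𝓢(Eucl d, ℂ)) (Y : Eucl d × Eucl d) :
    stft g f Y = ∫ x, f x * packet g Y x := by
  refine integral_congr_ae (.of_forall fun x => ?_)
  simp only [packet_apply, SchwartzMap.compCLMOfContinuousLinearEquiv_apply, Function.comp_apply,
    shearEquiv_apply, tensor_apply, smul_eq_mul]
  ring

variable {Q : Type} [NormedAddCommGroup Q] [NormedSpace ℝ Q]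

/-- The linear change of variables `((p, y), x) ↦ ((p, x), x - y)`. -/
noncomputable def paramShearEquiv (Q : Type) [NormedAddCommGroup Q] [NormedSpace ℝ Q] (d : ℕ) :
    ((Q × Eucl d) × Eucl d) ≃L[ℝ] (Q × Eucl d) × Eucl d where
  toFun p := ((p.1.1, p.2), p.2 - p.1.2)
  invFun p := ((p.1.1, p.1.2 - p.2), p.1.2)
  map_add' p q := by simp [add_sub_add_comm]
  map_smul' c p := by simp [smul_sub]
  left_inv p := by simp
  right_inv p := by simp
  continuous_toFun := by fun_prop
  continuous_invFun := by fun_prop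

/-- The short-time Fourier transform of a Schwartz function in its second argument. -/
noncomputable def paramStft (g : 𝓢(Eucl d, ℂ)) (G : 𝓢(Q × Eucl d, ℂ)) :
    𝓢(Q × (Eucl d × Eucl d), ℂ) :=
  SchwartzMap.compCLMOfContinuousLinearEquiv ℂ (ContinuousLinearEquiv.prodAssoc ℝ Q _ _).symm
    (partialFourier (SchwartzMap.compCLMOfContinuousLinearEquiv ℂ (paramShearEquiv Q d)
      (tensor G g)))

theorem paramStft_apply (g : 𝓢(Eucl d, ℂ)) (G : 𝓢(Q × Eucl d, ℂ)) (q : Q)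
    (Y : Eucl d × Eucl d) : paramStft g G (q, Y) = ∫ x, G (q, x) * packet g Y x := by
  refine integral_congr_ae (.of_forall fun x => ?_)
  change Complex.exp ((inner ℝ x Y.2 : ℝ) * Complex.I) * (G (q, x) * g (x - Y.1)) = _
  simp only [packet_apply]
  ring

/-- The linear change of variables `(x, Y) ↦ (Y, x - Y.1)`. -/
noncomputable def packetShearEquiv (d : ℕ) :
    (Eucl d × (Eucl d × Eucl d)) ≃L[ℝ] (Eucl d × Eucl d) × Eucl d where
  toFun p := (p.2, p.1 - p.2.1)
  invFun p := (p.2 + p.1.1, p.1)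
  map_add' p q := by simp [add_sub_add_comm]
  map_smul' c p := by simp [smul_sub]
  left_inv p := by simp
  right_inv p := by simp
  continuous_toFun := by fun_prop
  continuous_invFun := by fun_prop

/-- The Schwartz function `(x, Y) ↦ h Y * dualPacket g Y x`. -/
noncomputable def packetFamily (g : 𝓢(Eucl d, ℂ)) (h : 𝓢(Eucl d × Eucl d, ℂ)) :
    𝓢(Eucl d × (Eucl d × Eucl d), ℂ) :=
  SchwartzMap.smulLeftCLM ℂ (fun p : Eucl d × (Eucl d × Eucl d) =>
      Complex.exp ((inner ℝ (ContinuousLinearMap.fst ℝ _ _ p)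
        ((-(ContinuousLinearMap.snd ℝ _ _).comp (ContinuousLinearMap.snd ℝ _ _) :
          Eucl d × (Eucl d × Eucl d) →L[ℝ] Eucl d) p) : ℝ) * Complex.I))
    (SchwartzMap.compCLMOfContinuousLinearEquiv ℂ (packetShearEquiv d) (tensor h g))

theorem packetFamily_apply (g : 𝓢(Eucl d, ℂ)) (h : 𝓢(Eucl d × Eucl d, ℂ)) (x : Eucl d)
    (Y : Eucl d × Eucl d) : packetFamily g h (x, Y) = h Y * dualPacket g Y x := by
  have : packetShearEquiv d (x, Y) = (Y, x - Y.1) := rfl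
  rw [packetFamily, SchwartzMap.smulLeftCLM_apply_apply (hasTemperateGrowth_cexp_inner _ _)]
  simp [this, dualPacket_apply]
  ring

theorem slice_packetFamily (g : 𝓢(Eucl d, ℂ)) (h : 𝓢(Eucl d × Eucl d, ℂ))
    (Y : Eucl d × Eucl d) : slice (packetFamily g h) Y = h Y • dualPacket g Y := by
  ext x
  simp [packetFamily_apply]

theorem apply_slice_packetFamily (u : 𝓢'(Eucl d, ℂ)) (g : 𝓢(Eucl d, ℂ))
    (h : 𝓢(Eucl d × Eucl d, ℂ)) (Y : Eucl d × Eucl d) :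
    u (slice (packetFamily g h) Y) = h Y * u (dualPacket g Y) := by
  rw [slice_packetFamily, map_smul, smul_eq_mul]

/-! ### Fourier inversion and the reproducing formula -/

theorem integral_comp_two_pi_smul {W : Type} [NormedAddCommGroup W] [NormedSpace ℝ W]
    (F : Eucl d → W) :
    ∫ η, F η = (2 * Real.pi) ^ d • ∫ ξ, F ((2 * Real.pi) • ξ) := by
  rw [Measure.integral_comp_smul, smul_smul, finrank_euclideanSpace_fin,
    abs_of_nonneg (by positivity), mul_inv_cancel₀ (by positivity), one_smul]

/-- The factor (2π)^d is the Jacobian of η = 2πξ, which reduces the claim to inversion with phases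
e^{±2πi⟨z, ξ⟩}. -/
theorem fourier_inversion (h : 𝓢(Eucl d, ℂ)) (x : Eucl d) :
    ∫ η, Complex.exp ((-inner ℝ x η : ℝ) * Complex.I) *
      (∫ z, Complex.exp ((inner ℝ z η : ℝ) * Complex.I) * h z) =
      (((2 * Real.pi) ^ d : ℝ) : ℂ) * h x := by
  have h1 : ∀ ξ : Eucl d, ∫ z, Complex.exp ((inner ℝ z ((2 * Real.pi) • ξ) : ℝ) * Complex.I) * h z =
      FourierTransformInv.fourierInv (h : Eucl d → ℂ) ξ := by
    intro ξ
    rw [Real.fourierInv_eq']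
    refine integral_congr_ae (.of_forall fun z => ?_)
    simp only [inner_smul_right, smul_eq_mul]
  rw [integral_comp_two_pi_smul, ← Complex.coe_smul, smul_eq_mul]
  congr 1
  simp only [h1, ← SchwartzMap.fourierInv_coe]
  have h2 : FourierTransform.fourier (FourierTransformInv.fourierInv h) x = h x := by
    rw [FourierTransform.fourier_fourierInv_eq]
  rw [← h2, SchwartzMap.fourier_coe, Real.fourier_eq']
  refine integral_congr_ae (.of_forall fun ξ => ?_)
  have : (-inner ℝ x ((2 * Real.pi) • ξ) : ℝ) = -2 * Real.pi * inner ℝ ξ x := by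
    rw [inner_smul_right, real_inner_comm]
    ring
  simp only [this, smul_eq_mul]

end Packets
section Reproducing

variable {d : ℕ}

instance : (volume : Measure (Eucl d × Eucl d)).HasTemperateGrowth := by
  have : (volume : Measure (Eucl d × Eucl d)).IsAddHaarMeasure :=
    Measure.prod.instIsAddHaarMeasure _ _
  infer_instance

/-- Inversion in η at fixed y leaves (2π)^d f(x) g(x - y)², and integrating in y uses the
normalization. No conjugate appears because all pairings are bilinear, hence ∫ g·g rather than ∫
|g|². -/
theorem partialIntegral_packetFamily_stft {g : 𝓢(Eucl d, ℂ)} (hg : ∫ x, g x * g x = 1)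
    (f : 𝓢(Eucl d, ℂ)) :
    partialIntegral (packetFamily g (stft g f)) = (((2 * Real.pi) ^ d : ℝ) : ℂ) • f := by
  ext x
  have h1 : ∀ y : Eucl d, ∫ η, packetFamily g (stft g f) (x, (y, η)) =
      (((2 * Real.pi) ^ d : ℝ) : ℂ) * f x * (g (x - y) * g (x - y)) := by
    intro y
    have h2 := fourier_inversion (slice (swap
      (SchwartzMap.compCLMOfContinuousLinearEquiv ℂ (shearEquiv d) (tensor f g))) y) x
    have h3 : slice (swap
      (SchwartzMap.compCLMOfContinuousLinearEquiv ℂ (shearEquiv d) (tensor f g))) y x =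
        f x * g (x - y) := rfl
    rw [h3] at h2
    have h4 : ∀ η, packetFamily g (stft g f) (x, (y, η)) = g (x - y) *
        (Complex.exp ((-inner ℝ x η : ℝ) * Complex.I) *
        ∫ z, Complex.exp ((inner ℝ z η : ℝ) * Complex.I) * slice (swap
      (SchwartzMap.compCLMOfContinuousLinearEquiv ℂ (shearEquiv d) (tensor f g))) y z) := by
      intro η
      have h6 : stft g f (y, η) = ∫ z, Complex.exp ((inner ℝ z η : ℝ) * Complex.I) * slice (swap
        (SchwartzMap.compCLMOfContinuousLinearEquiv ℂ (shearEquiv d) (tensor f g))) y z := rfl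
      rw [packetFamily_apply, dualPacket_apply, ← h6]
      ring
    simp only [h4, integral_const_mul, h2]
    ring
  have h5 : Integrable (fun Y : Eucl d × Eucl d => packetFamily g (stft g f) (x, Y)) :=
    integrable_partial (packetFamily g (stft g f)) x
  change ∫ Y : Eucl d × Eucl d, packetFamily g (stft g f) (x, Y) = _
  rw [Measure.volume_eq_prod] at h5 ⊢
  rw [integral_prod _ h5]
  simp only [h1, integral_const_mul]
  rw [integral_sub_left_eq_self (fun y => g y * g y) volume x, hg, mul_one]
  rfl

/-- The reproducing formula for tempered distributions. -/
theorem apply_eq_integral_stft {g : 𝓢(Eucl d, ℂ)} (hg : ∫ x, g x * g x = 1)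
    (u : 𝓢'(Eucl d, ℂ)) (f : 𝓢(Eucl d, ℂ)) :
    u f = (((2 * Real.pi) ^ d : ℝ) : ℂ)⁻¹ * ∫ Y, stft g f Y * u (dualPacket g Y) := by
  have h1 := apply_partialIntegral u (packetFamily g (stft g f))
  rw [partialIntegral_packetFamily_stft hg, map_smul, smul_eq_mul] at h1
  simp only [apply_slice_packetFamily] at h1
  have h2 : (((2 * Real.pi) ^ d : ℝ) : ℂ) ≠ 0 := by
    have : (2 * Real.pi) ^ d ≠ 0 := by positivity
    exact_mod_cast this
  rw [← h1, inv_mul_cancel_left₀ h2]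

theorem norm_apply_le_integral_stft {g : 𝓢(Eucl d, ℂ)} (hg : ∫ x, g x * g x = 1)
    (u : 𝓢'(Eucl d, ℂ)) (f : 𝓢(Eucl d, ℂ)) :
    ‖u f‖ ≤ ∫ Y, ‖stft g f Y‖ * ‖u (dualPacket g Y)‖ := by
  rw [apply_eq_integral_stft hg, norm_mul, norm_inv, Complex.norm_real,
    Real.norm_of_nonneg (by positivity)]
  have h1 : ((2 * Real.pi) ^ d)⁻¹ ≤ 1 := by
    refine inv_le_one_of_one_le₀ (one_le_pow₀ ?_)
    linarith [Real.pi_gt_three]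
  calc _ ≤ 1 * ∫ Y, ‖stft g f Y * u (dualPacket g Y)‖ := by
        gcongr
        exact norm_integral_le_integral_norm _
    _ = _ := by simp only [one_mul, norm_mul]

/-- The exchange of phase space translations and the short-time Fourier transform. -/
theorem integral_modulate_mul_packet (g : 𝓢(Eucl d, ℂ)) (h : Eucl d → ℂ)
    (γ Y : Eucl d × Eucl d) :
    ∫ x, (Complex.exp ((-inner ℝ x γ.2 : ℝ) * Complex.I) * h (x - γ.1)) * packet g Y x =
      Complex.exp ((inner ℝ γ.1 (Y.2 - γ.2) : ℝ) * Complex.I) *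
        ∫ x, h x * packet g (Y - γ) x := by
  rw [← integral_const_mul, ← integral_add_right_eq_self _ γ.1]
  refine integral_congr_ae (.of_forall fun x => ?_)
  have h1 : x + γ.1 - Y.1 = x - (Y - γ).1 := by
    simp only [Prod.fst_sub]
    abel
  simp only [packet_apply, add_sub_cancel_right, h1, Prod.snd_sub]
  have h2 : Complex.exp ((-inner ℝ (x + γ.1) γ.2 : ℝ) * Complex.I) *
      Complex.exp ((inner ℝ (x + γ.1) Y.2 : ℝ) * Complex.I) =
      Complex.exp ((inner ℝ γ.1 (Y.2 - γ.2) : ℝ) * Complex.I) *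
      Complex.exp ((inner ℝ x (Y.2 - γ.2) : ℝ) * Complex.I) := by
    rw [← Complex.exp_add, ← Complex.exp_add, ← add_mul, ← add_mul, ← Complex.ofReal_add,
      ← Complex.ofReal_add]
    congr 3
    simp only [inner_add_left, inner_sub_right]
    ring
  linear_combination (h x * g (x - (Y.1 - γ.1))) * h2

theorem integral_modulate_mul_dualPacket (g : 𝓢(Eucl d, ℂ)) (h : Eucl d → ℂ)
    (γ Y : Eucl d × Eucl d) :
    ∫ x, (Complex.exp ((inner ℝ x γ.2 : ℝ) * Complex.I) * h (x - γ.1)) * dualPacket g Y x =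
      Complex.exp ((-inner ℝ γ.1 (Y.2 - γ.2) : ℝ) * Complex.I) *
        ∫ x, h x * dualPacket g (Y - γ) x := by
  have := integral_modulate_mul_packet g h (γ.1, -γ.2) (Y.1, -Y.2)
  simp only [inner_neg_right, neg_neg] at this
  simp only [dualPacket]
  rw [this]
  have h1 : (Y.1, -Y.2) - (γ.1, -γ.2) = ((Y - γ).1, -(Y - γ).2) := by
    simp only [Prod.mk_sub_mk, Prod.fst_sub, Prod.snd_sub]
    congr 1
    abel
  rw [h1]
  congr 4
  rw [← inner_neg_right]
  congr 1
  abel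

/-- Translation covariance: up to a unimodular factor, packets interact only through their phase
space difference. This yields the convolution-type kernel that bounds the coefficients of the
Riemann sums. -/
theorem norm_stft_dualPacket (g : 𝓢(Eucl d, ℂ)) (X Y : Eucl d × Eucl d) :
    ‖stft g (dualPacket g X) Y‖ = ‖stft g g (Y - X)‖ := by
  have h1 := integral_modulate_mul_packet g g X Y
  rw [stft_apply, stft_apply]
  simp only [dualPacket_apply]
  rw [h1, norm_mul, Complex.norm_exp_ofReal_mul_I, one_mul]

/-! ### The Weyl kernel as a Schwartz function of two variables -/

/-- The linear change of variables `(y, x) ↦ ((x + y)/2, x - y)`. -/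
noncomputable def midpointEquiv (d : ℕ) : (Eucl d × Eucl d) ≃L[ℝ] Eucl d × Eucl d where
  toFun p := ((1 / 2 : ℝ) • (p.2 + p.1), p.2 - p.1)
  invFun p := (p.1 - (1 / 2 : ℝ) • p.2, p.1 + (1 / 2 : ℝ) • p.2)
  map_add' p q := by
    simp only [Prod.fst_add, Prod.snd_add, Prod.mk_add_mk]
    congr 1 <;> module
  map_smul' c p := by
    simp only [Prod.smul_fst, Prod.smul_snd, RingHom.id_apply, Prod.smul_mk]
    congr 1 <;> module
  left_inv p := by
    refine Prod.ext ?_ ?_ <;> simp only <;> module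
  right_inv p := by
    refine Prod.ext ?_ ?_ <;> simp only <;> module
  continuous_toFun := by fun_prop
  continuous_invFun := by fun_prop

/-- The Weyl kernel `(y, x) ↦ K (x, y)` as a Schwartz function of two variables. -/
noncomputable def kernelMap (b : 𝓢(Eucl d × Eucl d, ℂ)) : 𝓢(Eucl d × Eucl d, ℂ) :=
  (((2 * Real.pi) ^ d : ℝ) : ℂ)⁻¹ •
    SchwartzMap.compCLMOfContinuousLinearEquiv ℂ (midpointEquiv d) (partialFourier b)

theorem kernelMap_apply (b : 𝓢(Eucl d × Eucl d, ℂ)) (x y : Eucl d) :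
    kernelMap b (y, x) = weylKernel b x y := by
  rw [weylKernel_apply]
  have h : kernelMap b (y, x) = (((2 * Real.pi) ^ d : ℝ) : ℂ)⁻¹ *
      ∫ θ, Complex.exp ((inner ℝ θ (x - y) : ℝ) * Complex.I) * b ((1 / 2 : ℝ) • (x + y), θ) := rfl
  rw [h]
  congr 2
  funext θ
  rw [real_inner_comm]

theorem slice_kernelMap (b : 𝓢(Eucl d × Eucl d, ℂ)) (x : Eucl d) :
    slice (kernelMap b) x = weylKernel b x := by
  ext y
  exact kernelMap_apply b x y

/-- Shifting θ by the covector part of γ produces the modulation. All γ are thereby reduced to the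
single symbol `translate χ 0`, the source of uniformity in γ. -/
theorem weylKernel_translate (χ : 𝓢(Eucl d × Eucl d, ℝ)) (γ : Eucl d × Eucl d) (x y : Eucl d) :
    weylKernel (translate χ γ) x y = Complex.exp ((inner ℝ (x - y) γ.2 : ℝ) * Complex.I) *
      weylKernel (translate χ 0) (x - γ.1) (y - γ.1) := by
  rw [weylKernel_apply, weylKernel_apply, mul_left_comm]
  congr 1
  rw [← integral_const_mul, ← integral_add_right_eq_self _ γ.2]
  refine integral_congr_ae (.of_forall fun θ => ?_)
  have h1 : translate χ γ ((1 / 2 : ℝ) • (x + y), θ + γ.2) =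
      translate χ 0 ((1 / 2 : ℝ) • (x - γ.1 + (y - γ.1)), θ) := by
    rw [translate_apply, translate_apply]
    congr 2
    refine Prod.ext ?_ ?_
    · simp only [Prod.fst_sub, Prod.fst_zero]
      module
    · simp
  simp only [h1, sub_sub_sub_cancel_right, inner_add_right, Complex.ofReal_add, add_mul,
    Complex.exp_add]
  ring

/-- The transpose of the Weyl quantization of `b`, applied to a Schwartz function. -/
noncomputable def weylTranspose (b : 𝓢(Eucl d × Eucl d, ℂ)) (f : 𝓢(Eucl d, ℂ)) : 𝓢(Eucl d, ℂ) :=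
  partialIntegral (SchwartzMap.smulLeftCLM ℂ (fun p : Eucl d × Eucl d => f p.2) (kernelMap b))

theorem hasTemperateGrowth_comp_snd (f : 𝓢(Eucl d, ℂ)) :
    Function.HasTemperateGrowth (fun p : Eucl d × Eucl d => f p.2) :=
  f.hasTemperateGrowth.comp (ContinuousLinearMap.snd ℝ (Eucl d) (Eucl d)).hasTemperateGrowth

theorem weylTranspose_apply (b : 𝓢(Eucl d × Eucl d, ℂ)) (f : 𝓢(Eucl d, ℂ)) (y : Eucl d) :
    weylTranspose b f y = ∫ x, weylKernel b x y * f x := by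
  refine integral_congr_ae (.of_forall fun x => ?_)
  simp only [SchwartzMap.smulLeftCLM_apply_apply (hasTemperateGrowth_comp_snd f), smul_eq_mul,
    kernelMap_apply, mul_comm]

theorem weylApply_eq_apply_slice (b : 𝓢(Eucl d × Eucl d, ℂ)) (u : 𝓢'(Eucl d, ℂ)) (x : Eucl d) :
    weylApply b u x = u (slice (kernelMap b) x) := by
  rw [slice_kernelMap]
  rfl

theorem continuous_weylApply (b : 𝓢(Eucl d × Eucl d, ℂ)) (u : 𝓢'(Eucl d, ℂ)) :
    Continuous (weylApply b u) := by
  rw [funext (weylApply_eq_apply_slice b u)]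
  exact continuous_apply_slice u (kernelMap b)

/-- The transpose is an x-integral of f(x) K(x, ·), and the distribution commutes with that
integral. -/
theorem apply_weylTranspose (b : 𝓢(Eucl d × Eucl d, ℂ)) (u : 𝓢'(Eucl d, ℂ)) (f : 𝓢(Eucl d, ℂ)) :
    u (weylTranspose b f) = ∫ x, f x * weylApply b u x := by
  rw [weylTranspose, apply_partialIntegral]
  refine integral_congr_ae (.of_forall fun x => ?_)
  have : slice (SchwartzMap.smulLeftCLM ℂ (fun p : Eucl d × Eucl d => f p.2) (kernelMap b)) x =
      f x • slice (kernelMap b) x := by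
    ext y
    simp [SchwartzMap.smulLeftCLM_apply_apply (hasTemperateGrowth_comp_snd f)]
  simp only [this, map_smul, smul_eq_mul, weylApply_eq_apply_slice]

end Reproducing
/-! ### Phase space localization of the Weyl operators `χ_γ^w` -/

section Localization

variable {d : ℕ}

theorem exists_norm_le_mul_inv_pow {A B : Type} [NormedAddCommGroup A] [NormedSpace ℝ A]
    [NormedAddCommGroup B] [NormedSpace ℝ B] (G : 𝓢(A × B, ℂ)) (K : ℕ) :
    ∃ C : ℝ, 0 ≤ C ∧ ∀ a b, ‖G (a, b)‖ ≤ C * ((1 + ‖a‖) ^ K)⁻¹ * ((1 + ‖b‖) ^ K)⁻¹ := by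
  refine ⟨2 ^ (2 * K) * ((Finset.Iic (2 * K, 0)).sup
        (fun m => SchwartzMap.seminorm ℝ m.1 m.2) G), by positivity, fun a b => ?_⟩
  have h := SchwartzMap.one_add_le_sup_seminorm_apply (𝕜 := ℝ) (m := (2 * K, 0)) (k := 2 * K)
    (n := 0) le_rfl le_rfl G (a, b)
  rw [norm_iteratedFDeriv_zero] at h
  have ha : 1 + ‖a‖ ≤ 1 + ‖(a, b)‖ := by linarith [norm_fst_le (a, b)]
  have hb : 1 + ‖b‖ ≤ 1 + ‖(a, b)‖ := by linarith [norm_snd_le (a, b)]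
  rw [← div_eq_mul_inv, ← div_eq_mul_inv, le_div_iff₀ (by positivity), le_div_iff₀ (by positivity)]
  refine le_trans ?_ h
  calc ‖G (a, b)‖ * (1 + ‖b‖) ^ K * (1 + ‖a‖) ^ K
      ≤ ‖G (a, b)‖ * (1 + ‖(a, b)‖) ^ K * (1 + ‖(a, b)‖) ^ K := by gcongr
    _ = (1 + ‖(a, b)‖) ^ (2 * K) * ‖G (a, b)‖ := by ring

theorem exists_norm_le_inv_pow {A : Type} [NormedAddCommGroup A] [NormedSpace ℝ A]
    (G : 𝓢(A, ℂ)) (K : ℕ) : ∃ C : ℝ, 0 ≤ C ∧ ∀ a, ‖G a‖ ≤ C * ((1 + ‖a‖) ^ K)⁻¹ := by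
  refine ⟨2 ^ K * ((Finset.Iic (K, 0)).sup
        (fun m => SchwartzMap.seminorm ℝ m.1 m.2) G), by positivity, fun a => ?_⟩
  have h := SchwartzMap.one_add_le_sup_seminorm_apply (𝕜 := ℝ) (m := (K, 0)) (k := K)
    (n := 0) le_rfl le_rfl G a
  rw [norm_iteratedFDeriv_zero] at h
  rw [← div_eq_mul_inv, le_div_iff₀ (by positivity), mul_comm]
  exact h

theorem cexp_inner_sub (x y η : Eucl d) :
    Complex.exp ((inner ℝ (x - y) η : ℝ) * Complex.I) =
      Complex.exp ((inner ℝ x η : ℝ) * Complex.I) *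
        Complex.exp ((-inner ℝ y η : ℝ) * Complex.I) := by
  rw [← Complex.exp_add, ← add_mul, ← Complex.ofReal_add, inner_sub_left, sub_eq_add_neg]

theorem norm_stft_weylKernel (g : 𝓢(Eucl d, ℂ)) (χ : 𝓢(Eucl d × Eucl d, ℝ))
    (γ Y : Eucl d × Eucl d) (x : Eucl d) :
    ‖stft g (weylKernel (translate χ γ) x) Y‖ =
      ‖paramStft g (swap (kernelMap (translate χ 0))) (x - γ.1, Y - γ)‖ := by
  rw [stft_apply, paramStft_apply]
  have h1 : ∀ y, weylKernel (translate χ γ) x y * packet g Y y =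
      Complex.exp ((inner ℝ x γ.2 : ℝ) * Complex.I) *
        ((Complex.exp ((-inner ℝ y γ.2 : ℝ) * Complex.I) *
          weylKernel (translate χ 0) (x - γ.1) (y - γ.1)) * packet g Y y) := by
    intro y
    rw [weylKernel_translate, cexp_inner_sub]
    ring
  simp only [h1, swap_apply, kernelMap_apply]
  rw [integral_const_mul,
    integral_modulate_mul_packet g (fun y => weylKernel (translate χ 0) (x - γ.1) y),
    norm_mul, norm_mul, Complex.norm_exp_ofReal_mul_I, Complex.norm_exp_ofReal_mul_I, one_mul,
    one_mul]

theorem weylTranspose_translate_dualPacket (g : 𝓢(Eucl d, ℂ)) (χ : 𝓢(Eucl d × Eucl d, ℝ))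
    (γ X : Eucl d × Eucl d) (y : Eucl d) :
    weylTranspose (translate χ γ) (dualPacket g X) y =
      Complex.exp ((-inner ℝ γ.1 (X.2 - γ.2) : ℝ) * Complex.I) *
        (Complex.exp ((-inner ℝ y γ.2 : ℝ) * Complex.I) *
          paramStft g (kernelMap (translate χ 0)) (y - γ.1, ((X - γ).1, -(X - γ).2))) := by
  rw [weylTranspose_apply, paramStft_apply]
  have h1 : ∀ x, weylKernel (translate χ γ) x y * dualPacket g X x =
      Complex.exp ((-inner ℝ y γ.2 : ℝ) * Complex.I) *
        ((Complex.exp ((inner ℝ x γ.2 : ℝ) * Complex.I) *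
          weylKernel (translate χ 0) (x - γ.1) (y - γ.1)) * dualPacket g X x) := by
    intro x
    rw [weylKernel_translate, cexp_inner_sub]
    ring
  simp only [h1]
  rw [integral_const_mul,
    integral_modulate_mul_dualPacket g (fun x => weylKernel (translate χ 0) x (y - γ.1))]
  simp only [kernelMap_apply, dualPacket]
  ring

/-- Covariance in both kernel variables: pairing each with a packet gives a fixed Schwartz function
of X - γ and Y - γ, up to phases and a sign. Its decay in both differences is what localizes χ_γ^w
near γ. -/
theorem norm_stft_weylTranspose (g : 𝓢(Eucl d, ℂ)) (χ : 𝓢(Eucl d × Eucl d, ℝ))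
    (γ X Y : Eucl d × Eucl d) :
    ‖stft g (weylTranspose (translate χ γ) (dualPacket g X)) Y‖ =
      ‖paramStft g (swap (paramStft g (kernelMap (translate χ 0))))
        (((X - γ).1, -(X - γ).2), Y - γ)‖ := by
  rw [stft_apply, paramStft_apply]
  simp only [weylTranspose_translate_dualPacket, swap_apply, mul_assoc]
  rw [integral_const_mul]
  simp only [← mul_assoc]
  rw [integral_modulate_mul_packet g (fun y => paramStft g (kernelMap (translate χ 0))
      (y, ((X - γ).1, -(X - γ).2))),
    norm_mul, norm_mul, Complex.norm_exp_ofReal_mul_I, Complex.norm_exp_ofReal_mul_I, one_mul,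
    one_mul]

theorem exists_norm_stft_weylKernel_le (g : 𝓢(Eucl d, ℂ)) (χ : 𝓢(Eucl d × Eucl d, ℝ)) (K : ℕ) :
    ∃ C : ℝ, 0 ≤ C ∧ ∀ γ Y x, ‖stft g (weylKernel (translate χ γ) x) Y‖ ≤
      C * ((1 + ‖x - γ.1‖) ^ K)⁻¹ * ((1 + ‖Y - γ‖) ^ K)⁻¹ := by
  obtain ⟨C, hC, h⟩ :=
    exists_norm_le_mul_inv_pow (paramStft g (swap (kernelMap (translate χ 0)))) K
  exact ⟨C, hC, fun γ Y x => (norm_stft_weylKernel g χ γ Y x).trans_le (h _ _)⟩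

theorem exists_norm_stft_weylTranspose_le (g : 𝓢(Eucl d, ℂ)) (χ : 𝓢(Eucl d × Eucl d, ℝ))
    (K : ℕ) : ∃ C : ℝ, 0 ≤ C ∧ ∀ γ X Y,
      ‖stft g (weylTranspose (translate χ γ) (dualPacket g X)) Y‖ ≤
      C * ((1 + ‖X - γ‖) ^ K)⁻¹ * ((1 + ‖Y - γ‖) ^ K)⁻¹ := by
  obtain ⟨C, hC, h⟩ :=
    exists_norm_le_mul_inv_pow (paramStft g (swap (paramStft g (kernelMap (translate χ 0))))) K
  refine ⟨C, hC, fun γ X Y => (norm_stft_weylTranspose g χ γ X Y).trans_le ((h _ _).trans_eq ?_)⟩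
  have : ‖((X - γ).1, -(X - γ).2)‖ = ‖X - γ‖ := by simp [Prod.norm_def, -Prod.fst_sub, -Prod.snd_sub]
  rw [this]

/-! ### The partition of unity on the operator level -/

theorem integrable_schwartz (G : 𝓢(Eucl d × Eucl d, ℂ)) :
    Integrable G ((volume : Measure (Eucl d)).prod volume) := by
  rw [← Measure.volume_eq_prod]
  exact G.integrable

theorem integral_swap_schwartz (G : 𝓢(Eucl d × Eucl d, ℂ)) :
    ∫ x, ∫ y, G (x, y) = ∫ y, ∫ x, G (x, y) :=
  integral_integral_swap (f := fun x y => G (x, y)) (integrable_schwartz G)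

/-- The linear change of variables `(y, q) ↦ (y, y + q)`. -/
noncomputable def addEquiv (d : ℕ) : (Eucl d × Eucl d) ≃L[ℝ] Eucl d × Eucl d where
  toFun p := (p.1, p.1 + p.2)
  invFun p := (p.1, p.2 - p.1)
  map_add' p q := by simp [add_add_add_comm]
  map_smul' c p := by simp
  left_inv p := by simp
  right_inv p := by simp
  continuous_toFun := by fun_prop
  continuous_invFun := by fun_prop

/-- The change of variables has unit Jacobian; it is carried out as two translations with Fubini in
between. -/
theorem integral_comp_midpointEquiv_symm (H : 𝓢(Eucl d × Eucl d, ℂ)) :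
    ∫ y, ∫ x, H (y, x) = ∫ p, ∫ q, H ((midpointEquiv d).symm (p, q)) := by
  have h1 : ∀ y, ∫ x, H (y, x) =
      ∫ q, SchwartzMap.compCLMOfContinuousLinearEquiv ℂ (addEquiv d) H (y, q) :=
    fun y => (integral_add_left_eq_self (fun x => H (y, x)) y).symm
  simp only [h1]
  rw [integral_swap_schwartz]
  have h2 : ∀ q, ∫ y, SchwartzMap.compCLMOfContinuousLinearEquiv ℂ (addEquiv d) H (y, q) =
      ∫ p, SchwartzMap.compCLMOfContinuousLinearEquiv ℂ (midpointEquiv d).symm H (p, q) := by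
    intro q
    rw [← integral_sub_right_eq_self _ ((1 / 2 : ℝ) • q)]
    refine integral_congr_ae (.of_forall fun p => ?_)
    change H (p - (1 / 2 : ℝ) • q, p - (1 / 2 : ℝ) • q + q) =
      H (p - (1 / 2 : ℝ) • q, p + (1 / 2 : ℝ) • q)
    congr 2
    module
  simp only [h2]
  rw [← integral_swap_schwartz]
  rfl

/-- The Wigner type transform dual to the Weyl quantization. -/
noncomputable def wigner (f h : 𝓢(Eucl d, ℂ)) : 𝓢(Eucl d × Eucl d, ℂ) :=
  partialFourier (SchwartzMap.compCLMOfContinuousLinearEquiv ℂ (midpointEquiv d).symm (tensor h f))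

/-- The multiplication formula for the Fourier transform: Fubini and the symmetry of the phase. -/
theorem integral_partialFourier_mul (b G : 𝓢(Eucl d × Eucl d, ℂ)) (p : Eucl d) :
    ∫ q, partialFourier b (p, q) * G (p, q) = ∫ θ, b (p, θ) * partialFourier G (p, θ) := by
  simp only [partialFourier_apply, smul_eq_mul, ← integral_const_mul, ← integral_mul_const]
  rw [integral_integral_swap]
  · refine integral_congr_ae (.of_forall fun θ => integral_congr_ae (.of_forall fun q => ?_))
    simp only [real_inner_comm]
    ring
  · have h1 := integrable_schwartz (tensor (slice (swap G) p) (slice (swap b) p))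
    refine h1.mono ?_ (.of_forall fun z => ?_)
    · refine Continuous.aestronglyMeasurable ?_
      have := b.continuous
      have := G.continuous
      simp only [Function.uncurry_def]
      fun_prop
    · simp only [Function.uncurry_def, norm_mul, Complex.norm_exp_ofReal_mul_I, one_mul]
      rw [tensor_apply, norm_mul, mul_comm]
      rfl

/-- Weyl-Wigner duality makes matrix elements explicit linear integrals of the symbol, so identities
between symbols pass to operators. -/
theorem integral_weylTranspose_mul (b : 𝓢(Eucl d × Eucl d, ℂ)) (f h : 𝓢(Eucl d, ℂ)) :
    ∫ y, weylTranspose b f y * h y =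
      (((2 * Real.pi) ^ d : ℝ) : ℂ)⁻¹ * ∫ Z, b Z * wigner f h Z := by
  set H : 𝓢(Eucl d × Eucl d, ℂ) := SchwartzMap.pairing (ContinuousLinearMap.mul ℂ ℂ)
    (kernelMap b) (tensor h f) with hH
  have h1 : ∫ y, weylTranspose b f y * h y = ∫ y, ∫ x, H (y, x) := by
    refine integral_congr_ae (.of_forall fun y => ?_)
    simp only [weylTranspose_apply, ← integral_mul_const]
    refine integral_congr_ae (.of_forall fun x => ?_)
    simp only [hH, SchwartzMap.pairing_apply_apply, kernelMap_apply, tensor_apply,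
      ContinuousLinearMap.mul_apply']
    ring
  have h2 : ∀ p q, H ((midpointEquiv d).symm (p, q)) = (((2 * Real.pi) ^ d : ℝ) : ℂ)⁻¹ *
      (partialFourier b (p, q) * SchwartzMap.compCLMOfContinuousLinearEquiv ℂ
        (midpointEquiv d).symm (tensor h f) (p, q)) := by
    intro p q
    rw [hH, SchwartzMap.pairing_apply_apply, kernelMap, ContinuousLinearMap.mul_apply',
      smul_apply, SchwartzMap.compCLMOfContinuousLinearEquiv_apply,
      Function.comp_apply, ContinuousLinearEquiv.apply_symm_apply, smul_eq_mul, mul_assoc]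
    rfl
  have h3 : Integrable (fun Z => b Z * wigner f h Z)
      ((volume : Measure (Eucl d)).prod volume) := by
    have := integrable_schwartz
      (SchwartzMap.pairing (ContinuousLinearMap.mul ℂ ℂ) b (wigner f h))
    exact this
  rw [h1, integral_comp_midpointEquiv_symm, Measure.volume_eq_prod, integral_prod _ h3]
  simp only [h2, integral_const_mul, integral_partialFourier_mul]
  rfl

/-- In effect, the symbol 1 quantizes to the identity: integrating out the frequency by Fourier
inversion at 0 restricts to the diagonal. -/
theorem integral_wigner (f h : 𝓢(Eucl d, ℂ)) :
    ∫ Z, wigner f h Z = (((2 * Real.pi) ^ d : ℝ) : ℂ) * ∫ y, f y * h y := by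
  rw [Measure.volume_eq_prod, integral_prod _ (integrable_schwartz _), ← integral_const_mul]
  refine integral_congr_ae (.of_forall fun p => ?_)
  have h1 := fourier_inversion (slice (swap (SchwartzMap.compCLMOfContinuousLinearEquiv ℂ
    (midpointEquiv d).symm (tensor h f))) p) 0
  simp only [inner_zero_left, neg_zero, Complex.ofReal_zero, zero_mul, Complex.exp_zero,
    one_mul] at h1
  have h2 : slice (swap (SchwartzMap.compCLMOfContinuousLinearEquiv ℂ
    (midpointEquiv d).symm (tensor h f))) p 0 = f p * h p := by
    change h (p - (1 / 2 : ℝ) • (0 : Eucl d)) * f (p + (1 / 2 : ℝ) • (0 : Eucl d)) = _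
    rw [smul_zero, sub_zero, add_zero, mul_comm]
  rw [h2] at h1
  exact h1

/-- Weakly, the operators sum to the identity. Since χ ≥ 0, the absolute values of the terms sum to
|`wigner f h`|, which is integrable, so sum and integral may be exchanged. -/
theorem hasSum_integral_weylTranspose_mul {Γ : Submodule ℤ (Eucl d × Eucl d)} [Countable Γ]
    {χ : 𝓢(Eucl d × Eucl d, ℝ)} (hχ : IsLatticePartition Γ χ) (f h : 𝓢(Eucl d, ℂ)) :
    HasSum (fun γ : Γ => ∫ y, weylTranspose (translate χ γ) f y * h y) (∫ y, f y * h y) := by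
  have hpi : (((2 * Real.pi) ^ d : ℝ) : ℂ) ≠ 0 := by
    have : (2 * Real.pi) ^ d ≠ 0 := by positivity
    exact_mod_cast this
  have h1 : HasSum (fun γ : Γ => ∫ Z, translate χ γ Z * wigner f h Z) (∫ Z, wigner f h Z) := by
    refine hasSum_integral_of_dominated_convergence
      (fun (γ : Γ) Z => χ (Z - (γ : Eucl d × Eucl d)) * ‖wigner f h Z‖)
      (fun γ => ((translate χ γ).continuous.mul (wigner f h).continuous).aestronglyMeasurable)
      (fun γ => .of_forall fun Z => ?_) (.of_forall fun Z => ?_) ?_ (.of_forall fun Z => ?_)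
    · rw [norm_mul, translate_apply, Complex.norm_real, Real.norm_of_nonneg (hχ.nonneg _)]
    · exact ((hχ.hasSum Z).mul_right _).summable
    · have : (fun Z => ∑' γ : Γ, χ (Z - (γ : Eucl d × Eucl d)) * ‖wigner f h Z‖) =
          fun Z => ‖wigner f h Z‖ := by
        funext Z
        rw [((hχ.hasSum Z).mul_right _).tsum_eq, one_mul]
      rw [this]
      exact (wigner f h).integrable.norm
    · have := (Complex.hasSum_ofReal.2 (hχ.hasSum Z)).mul_right (wigner f h Z)
      simpa only [translate_apply, Complex.ofReal_one, one_mul] using this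
  have h2 := h1.mul_left (((2 * Real.pi) ^ d : ℝ) : ℂ)⁻¹
  rw [integral_wigner, inv_mul_cancel_left₀ hpi] at h2
  simpa only [integral_weylTranspose_mul] using h2

end Localization
/-! ### Lattice sums, order functions and absorption -/

section Estimates

variable {d : ℕ}

theorem one_add_norm_sub_le {V : Type} [NormedAddCommGroup V] (a b c : V) :
    1 + ‖a - c‖ ≤ (1 + ‖a - b‖) * (1 + ‖b - c‖) := by
  have h1 := norm_sub_le_norm_sub_add_norm_sub a b c
  nlinarith [norm_nonneg (a - b), norm_nonneg (b - c)]

theorem exists_norm_sub_lattice_le {V : Type} [NormedAddCommGroup V] [NormedSpace ℝ V]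
    [FiniteDimensional ℝ V] (Γ : Submodule ℤ V) [DiscreteTopology Γ] [IsZLattice ℝ Γ] :
    ∃ R : ℝ, 0 ≤ R ∧ ∀ X : V, ∃ γ : Γ, ‖X - γ‖ ≤ R := by
  have := ZLattice.module_free ℝ Γ
  have := ZLattice.module_finite ℝ Γ
  set b := (Module.Free.chooseBasis ℤ Γ).ofZLatticeBasis ℝ Γ
  refine ⟨∑ i, ‖b i‖, by positivity, fun X => ?_⟩
  have h : ((ZSpan.floor b X : Submodule.span ℤ (Set.range b)) : V) ∈ Γ := by
    have hs : Submodule.span ℤ (Set.range b) = Γ :=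
      (Module.Free.chooseBasis ℤ Γ).ofZLatticeBasis_span ℝ
    exact hs.le (ZSpan.floor b X).2
  exact ⟨⟨_, h⟩, ZSpan.norm_fract_le b X⟩

/-- Uniformity in X comes from recentring at a lattice point within the covering radius R, at the
cost of (1 + R)^K. -/
theorem exists_tsum_lattice_le {V : Type} [NormedAddCommGroup V] [NormedSpace ℝ V]
    [FiniteDimensional ℝ V] (Γ : Submodule ℤ V) [DiscreteTopology Γ] [IsZLattice ℝ Γ] :
    ∃ (K : ℕ) (C : ℝ), 0 ≤ C ∧ ∀ X : V,
      Summable (fun γ : Γ => ((1 + ‖X - γ‖) ^ K)⁻¹) ∧ ∑' γ : Γ, ((1 + ‖X - γ‖) ^ K)⁻¹ ≤ C := by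
  set K := Module.finrank ℤ Γ + 1
  have h0 : Summable (fun γ : Γ => ((1 + ‖γ‖) ^ K)⁻¹) := by
    refine Summable.of_norm_bounded_eventually
      (ZLattice.summable_norm_pow_inv Γ K (Nat.lt_succ_self _)) ?_
    -- The origin is exempt from the comparison: there ‖γ‖⁻¹ takes the value 0.
    refine (Set.finite_singleton (0 : Γ)).subset fun γ hγ => ?_
    by_contra h
    have hpos : 0 < ‖γ‖ := norm_pos_iff.2 h
    refine hγ ?_
    change ‖((1 + ‖γ‖) ^ K)⁻¹‖ ≤ ‖γ‖⁻¹ ^ K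
    rw [Real.norm_of_nonneg (by positivity), inv_pow]
    gcongr
    linarith
  obtain ⟨R, hR, hRX⟩ := exists_norm_sub_lattice_le Γ
  refine ⟨K, (1 + R) ^ K * ∑' γ : Γ, ((1 + ‖γ‖) ^ K)⁻¹, by positivity, fun X => ?_⟩
  obtain ⟨γ₀, hγ₀⟩ := hRX X
  have h1 : ∀ γ : Γ, ((1 + ‖X - ((γ + γ₀ : Γ) : V)‖) ^ K)⁻¹ ≤
      (1 + R) ^ K * ((1 + ‖γ‖) ^ K)⁻¹ := by
    intro γ
    rw [← div_eq_mul_inv, le_div_iff₀ (by positivity), inv_mul_le_iff₀ (by positivity), ← mul_pow]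
    gcongr
    have h2 := one_add_norm_sub_le (γ : V) (X - γ₀) 0
    rw [sub_zero, sub_zero, norm_sub_rev] at h2
    refine h2.trans ?_
    have h3 : X - γ₀ - (γ : V) = X - ((γ + γ₀ : Γ) : V) := by
      push_cast
      abel
    rw [h3]
    gcongr
  have h2 : Summable fun γ : Γ => ((1 + ‖X - ((γ + γ₀ : Γ) : V)‖) ^ K)⁻¹ :=
    Summable.of_nonneg_of_le (fun γ => by positivity) h1 (h0.mul_left _)
  refine ⟨((Equiv.addRight γ₀).summable_iff).1 h2, ?_⟩
  rw [← (Equiv.addRight γ₀).tsum_eq, ← tsum_mul_left]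
  exact h2.tsum_le_tsum h1 (h0.mul_left _)

theorem IsOrderFunction.exists_le {m : Eucl d × Eucl d → ℝ} (hm : IsOrderFunction m) :
    ∃ (C : ℝ) (N : ℕ), 1 ≤ C ∧ ∀ X Y, m X ≤ C * (1 + ‖X - Y‖) ^ N * m Y := by
  obtain ⟨C₀, N₀, hC₀, hN₀, h⟩ := hm.growth
  -- The power of 2 compares the Euclidean bracket with the maximum norm; the maximum with 1 ensures
  -- `1 ≤ C`, needed when a polynomial weight is added to m.
  refine ⟨max 1 (C₀ * 2 ^ ⌈N₀⌉₊), ⌈N₀⌉₊, le_max_left _ _, fun X Y => (h X Y).trans ?_⟩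
  have hmY := hm.pos Y
  gcongr ?_ * _
  have h1 : Real.sqrt (1 + ‖X.1 - Y.1‖ ^ 2 + ‖X.2 - Y.2‖ ^ 2) ≤ 2 * (1 + ‖X - Y‖) := by
    have ha : ‖X.1 - Y.1‖ ≤ ‖X - Y‖ := norm_fst_le (X - Y)
    have hb : ‖X.2 - Y.2‖ ≤ ‖X - Y‖ := norm_snd_le (X - Y)
    have h0 := norm_nonneg (X - Y)
    refine Real.sqrt_le_iff.2 ⟨by positivity, ?_⟩
    have ha2 := pow_le_pow_left₀ (norm_nonneg _) ha 2
    have hb2 := pow_le_pow_left₀ (norm_nonneg _) hb 2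
    nlinarith
  have h2 : (1 : ℝ) ≤ 2 * (1 + ‖X - Y‖) := by linarith [norm_nonneg (X - Y)]
  calc C₀ * Real.sqrt (1 + ‖X.1 - Y.1‖ ^ 2 + ‖X.2 - Y.2‖ ^ 2) ^ N₀
      ≤ C₀ * (2 * (1 + ‖X - Y‖)) ^ (⌈N₀⌉₊ : ℝ) := by
        gcongr
        exact (Real.rpow_le_rpow (Real.sqrt_nonneg _) h1 hN₀.le).trans
          (Real.rpow_le_rpow_of_exponent_le h2 (Nat.le_ceil _))
    _ = C₀ * 2 ^ ⌈N₀⌉₊ * (1 + ‖X - Y‖) ^ ⌈N₀⌉₊ := by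
        rw [Real.rpow_natCast, mul_pow, mul_assoc]
    _ ≤ _ := by
        gcongr
        exact le_max_right _ _

/-- If `φ` grows polynomially and its values are controlled by `m` up to a small multiple of its
size relative to a polynomial weight, then `φ` is controlled by `m`. -/
theorem exists_le_mul_of_absorption {V : Type} [NormedAddCommGroup V] {m φ : V → ℝ} {C B D : ℝ}
    {N : ℕ} (hm0 : ∀ X, 0 < m X) (hC : 1 ≤ C) (hm : ∀ X Y, m X ≤ C * (1 + ‖X - Y‖) ^ N * m Y)
    (hφ0 : ∀ X, 0 ≤ φ X) (hφ : ∀ X, φ X ≤ B * (1 + ‖X‖) ^ N) (hD : 0 ≤ D)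
    (h : ∀ R : ℝ, 0 ≤ R → ∃ S : ℝ, 0 ≤ S ∧ ∀ (X : V) (A : ℝ), 0 ≤ A →
      (∀ Y, φ Y ≤ A * (1 + ‖Y - X‖) ^ N) → φ X ≤ S * m X + D * (1 + R)⁻¹ * A) :
    ∃ S : ℝ, 0 ≤ S ∧ ∀ X, φ X ≤ S * m X := by
  -- This radius makes D C/(1 + R) at most 1/2, so the error can be absorbed.
  obtain ⟨S, hS0, hS⟩ := h (2 * D * C) (by positivity)
  refine ⟨2 * S, by positivity, fun X => ?_⟩
  have hB : 0 ≤ B := by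
    have := (hφ0 0).trans (hφ 0)
    simpa using this
  -- The added polynomial weight makes the supremum of φ/w finite a priori, while w still satisfies
  -- the order inequality with the same C and N. The bound 2S does not depend on ε, which then tends
  -- to 0.
  have key : ∀ ε : ℝ, 0 < ε → ∀ X, φ X ≤ 2 * S * (m X + ε * (1 + ‖X‖) ^ N) := by
    intro ε hε
    set w : V → ℝ := fun X => m X + ε * (1 + ‖X‖) ^ N with hw
    have hw0 : ∀ X, 0 < w X := fun X => add_pos (hm0 X) (by positivity)
    have hwC : ∀ X Y, w Y ≤ C * (1 + ‖Y - X‖) ^ N * w X := by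
      intro X Y
      have h1 := one_add_norm_sub_le Y X 0
      rw [sub_zero, sub_zero] at h1
      have h2 : (1 + ‖Y‖) ^ N ≤ C * ((1 + ‖Y - X‖) ^ N * (1 + ‖X‖) ^ N) := by
        refine le_trans ?_ (le_mul_of_one_le_left (by positivity) hC)
        rw [← mul_pow]
        gcongr
      calc w Y ≤ C * (1 + ‖Y - X‖) ^ N * m X +
            ε * (C * ((1 + ‖Y - X‖) ^ N * (1 + ‖X‖) ^ N)) := by
            exact add_le_add (hm Y X) (mul_le_mul_of_nonneg_left h2 hε.le)
        _ = _ := by rw [hw]; ring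
    have hbdd : BddAbove (Set.range fun X => φ X / w X) := by
      refine ⟨B / ε, ?_⟩
      rintro _ ⟨X, rfl⟩
      beta_reduce
      rw [div_le_div_iff₀ (hw0 X) hε]
      have h1 := hφ X
      have h2 : ε * (1 + ‖X‖) ^ N ≤ w X := by linarith [hm0 X]
      calc φ X * ε ≤ B * (1 + ‖X‖) ^ N * ε := by gcongr
        _ = B * (ε * (1 + ‖X‖) ^ N) := by ring
        _ ≤ B * w X := by gcongr
    set A := ⨆ X, φ X / w X with hA
    have hA0 : 0 ≤ A := (div_nonneg (hφ0 0) (hw0 0).le).trans (le_ciSup hbdd 0)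
    have hφA : ∀ X, φ X ≤ A * w X := fun X => (div_le_iff₀ (hw0 X)).1 (le_ciSup hbdd X)
    have h1 : A ≤ S + A / 2 := by
      have : Nonempty V := ⟨0⟩
      refine ciSup_le fun X => ?_
      rw [div_le_iff₀ (hw0 X)]
      have h2 := hS X (A * (C * w X)) (by have := (hw0 X).le; positivity) fun Y =>
        (hφA Y).trans (by
          have := mul_le_mul_of_nonneg_left (hwC X Y) hA0
          linarith)
      have h3 : D * (1 + 2 * D * C)⁻¹ * (A * (C * w X)) ≤ A / 2 * w X := by
        have h4 : D * C * (1 + 2 * D * C)⁻¹ ≤ 1 / 2 := by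
          rw [← div_eq_mul_inv, div_le_div_iff₀ (by positivity) (by norm_num)]
          linarith
        have h5 := mul_le_mul_of_nonneg_right h4 (mul_nonneg hA0 (hw0 X).le)
        linarith
      have h6 : S * m X ≤ S * w X := by
        have : m X ≤ w X := le_add_of_nonneg_right (by positivity)
        gcongr
      linarith
    intro X
    exact (hφA X).trans (mul_le_mul_of_nonneg_right (by linarith) (hw0 X).le)
  have hlim : Tendsto (fun ε : ℝ => 2 * S * (m X + ε * (1 + ‖X‖) ^ N)) (𝓝[>] 0)
      (𝓝 (2 * S * (m X + 0 * (1 + ‖X‖) ^ N))) := by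
    refine Tendsto.mono_left ?_ nhdsWithin_le_nhds
    exact Continuous.tendsto (by fun_prop) 0
  rw [zero_mul, add_zero] at hlim
  exact ge_of_tendsto hlim (eventually_mem_nhdsWithin.mono fun ε hε => key ε hε X)

/-! ### The local `L²` bounds -/

theorem eLpNorm_comp_sub_right {f : Eucl d → ℝ} (hf : AEStronglyMeasurable f) (y : Eucl d) :
    eLpNorm (fun x => f (x - y)) 2 volume = eLpNorm f 2 volume :=
  eLpNorm_comp_measurePreserving hf (measurePreserving_sub_right volume y)

theorem eLpNorm_packet (g : 𝓢(Eucl d, ℂ)) (Y : Eucl d × Eucl d) :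
    eLpNorm (packet g Y) 2 volume = eLpNorm g 2 volume := by
  rw [← eLpNorm_norm g, ← eLpNorm_comp_sub_right g.continuous.norm.aestronglyMeasurable Y.1]
  refine eLpNorm_congr_norm_ae (.of_forall fun x => ?_)
  rw [norm_packet_apply, norm_norm]

theorem enorm_integral_mul_le {f h : Eucl d → ℂ} (hf : AEStronglyMeasurable f)
    (hh : AEStronglyMeasurable h) :
    ‖∫ x, f x * h x‖ₑ ≤ eLpNorm f 2 volume * eLpNorm h 2 volume := by
  have h1 := eLpNorm_smul_le_mul_eLpNorm (p := 2) (q := 2) (r := 1) hh hf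
  refine (enorm_integral_le_lintegral_enorm _).trans ?_
  rw [eLpNorm_one_eq_lintegral_enorm] at h1
  exact h1

theorem eLpNorm_weylApply_le {m : Eucl d × Eucl d → ℝ} {Γ : Submodule ℤ (Eucl d × Eucl d)}
    {χ : 𝓢(Eucl d × Eucl d, ℝ)} {u : 𝓢'(Eucl d, ℂ)} (hm : ∀ X, 0 < m X)
    (hu : u ∈ symbolSpace m Γ χ) (γ : Γ) :
    eLpNorm (weylApply (translate χ γ) u) 2 volume ≤
      ENNReal.ofReal ((symbolNorm m Γ χ u).toReal * m γ) := by
  have h1 : eLpNorm (weylApply (translate χ γ) u) 2 volume / ENNReal.ofReal (m γ) ≤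
      symbolNorm m Γ χ u :=
    le_iSup (fun γ : Γ => eLpNorm (weylApply (translate χ γ) u) 2 volume /
      ENNReal.ofReal (m γ)) γ
  rw [ENNReal.ofReal_mul ENNReal.toReal_nonneg, ENNReal.ofReal_toReal (ne_of_lt hu)]
  exact (ENNReal.div_le_iff (by simpa using hm γ) ENNReal.ofReal_ne_top).1 h1

theorem norm_apply_weylTranspose_le {m : Eucl d × Eucl d → ℝ}
    {Γ : Submodule ℤ (Eucl d × Eucl d)}
    {χ : 𝓢(Eucl d × Eucl d, ℝ)} {u : 𝓢'(Eucl d, ℂ)} (hm : ∀ X, 0 < m X)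
    (hu : u ∈ symbolSpace m Γ χ) (γ : Γ) (g : 𝓢(Eucl d, ℂ)) (X : Eucl d × Eucl d) :
    ‖u (weylTranspose (translate χ γ) (dualPacket g X))‖ ≤
      (eLpNorm g 2 volume).toReal * ((symbolNorm m Γ χ u).toReal * m γ) := by
  have h1 := enorm_integral_mul_le (dualPacket g X).continuous.aestronglyMeasurable
    (continuous_weylApply (translate χ γ) u).aestronglyMeasurable
  have h0 : 0 ≤ (symbolNorm m Γ χ u).toReal * m γ :=
    mul_nonneg ENNReal.toReal_nonneg (hm γ).le
  rw [← apply_weylTranspose, dualPacket, eLpNorm_packet] at h1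
  have h2 := h1.trans (mul_le_mul_right (eLpNorm_weylApply_le hm hu γ) _)
  have h3 : eLpNorm g 2 volume ≠ ⊤ := (g.eLpNorm_lt_top 2 volume).ne
  have h4 := ENNReal.toReal_mono (ENNReal.mul_ne_top h3 ENNReal.ofReal_ne_top) h2
  rwa [toReal_enorm, ENNReal.toReal_mul, ENNReal.toReal_ofReal h0] at h4

end Estimates
/-! ### Control of wave packet coefficients up to an absorbable error -/

section WavePackets

variable {d : ℕ}

theorem integrable_mul_schwartz (f h : 𝓢(Eucl d, ℂ)) : Integrable fun x => f x * h x :=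
  (f.memLp 2 volume).integrable_mul (h.memLp 2 volume)

theorem stft_sub_sum {ι : Type} (g f : 𝓢(Eucl d, ℂ)) (S : Finset ι) (F : ι → 𝓢(Eucl d, ℂ))
    (Y : Eucl d × Eucl d) :
    stft g (f - ∑ i ∈ S, F i) Y = stft g f Y - ∑ i ∈ S, stft g (F i) Y := by
  simp only [stft_apply]
  rw [← integral_finsetSum _ fun i _ => integrable_mul_schwartz _ _,
    ← integral_sub (integrable_mul_schwartz _ _)
      (integrable_finsetSum _ fun i _ => integrable_mul_schwartz _ _)]
  refine integral_congr_ae (.of_forall fun x => ?_)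
  simp [sub_mul, Finset.sum_mul]

instance : (volume : Measure (Eucl d × Eucl d)).IsAddHaarMeasure :=
  inferInstanceAs ((volume : Measure (Eucl d)).prod volume).IsAddHaarMeasure

theorem integrable_inv_one_add_norm_sub_pow (X : Eucl d × Eucl d) :
    Integrable (fun Y : Eucl d × Eucl d =>
      ((1 + ‖Y - X‖) ^ (volume : Measure (Eucl d × Eucl d)).integrablePower)⁻¹) :=
  (integrable_inv_one_add_norm_pow (Eucl d × Eucl d)).comp_sub_right X

theorem integral_inv_one_add_norm_sub_pow (X : Eucl d × Eucl d) :
    ∫ Y : Eucl d × Eucl d,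
      ((1 + ‖Y - X‖) ^ (volume : Measure (Eucl d × Eucl d)).integrablePower)⁻¹ =
    ∫ Y : Eucl d × Eucl d, ((1 + ‖Y‖) ^ (volume : Measure (Eucl d × Eucl d)).integrablePower)⁻¹ :=
  integral_sub_right_eq_self (fun Y : Eucl d × Eucl d =>
    ((1 + ‖Y‖) ^ (volume : Measure (Eucl d × Eucl d)).integrablePower)⁻¹) X

/-- Summability forces the terms to 0 along the cofinite filter, whereas in a ball they stay bounded
below. -/
theorem finite_norm_sub_lattice_le {V : Type} [NormedAddCommGroup V] {Γ : Set V} {X : V}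
    {K : ℕ} (h : Summable (fun γ : Γ => ((1 + ‖X - γ‖) ^ K)⁻¹)) (R : ℝ) :
    {γ : Γ | ‖X - γ‖ ≤ R}.Finite := by
  have h1 : ∀ᶠ γ : Γ in cofinite, ((1 + ‖X - γ‖) ^ K)⁻¹ < ((1 + |R|) ^ K)⁻¹ :=
    h.tendsto_cofinite_zero.eventually_lt_const (by positivity)
  refine (eventually_cofinite.1 h1).subset fun γ hγ => ?_
  have h2 : ‖X - γ‖ ≤ R := hγ
  change ¬ ((1 + ‖X - γ‖) ^ K)⁻¹ < ((1 + |R|) ^ K)⁻¹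
  rw [not_lt]
  gcongr
  exact h2.trans (le_abs_self R)

/-- Lattice points within R of X are handled by the L² bounds; the rest is treated as one remainder
through the reproducing formula, since the partition sum is only known to converge weakly. The
constant `D` is chosen before `R`, as absorption requires. -/
theorem exists_norm_apply_dualPacket_absorption {m : Eucl d × Eucl d → ℝ}
    {Γ : Submodule ℤ (Eucl d × Eucl d)} [DiscreteTopology Γ] [IsZLattice ℝ Γ]
    {χ : 𝓢(Eucl d × Eucl d, ℝ)} (hχ : IsLatticePartition Γ χ) {u : 𝓢'(Eucl d, ℂ)}
    (hm : ∀ X, 0 < m X) (hu : u ∈ symbolSpace m Γ χ) {g : 𝓢(Eucl d, ℂ)}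
    (hg : ∫ x, g x * g x = 1) {Cm : ℝ} {N : ℕ} (hCm : 1 ≤ Cm)
    (hmN : ∀ X Y, m X ≤ Cm * (1 + ‖X - Y‖) ^ N * m Y) :
    ∃ D : ℝ, 0 ≤ D ∧ ∀ R : ℝ, 0 ≤ R → ∃ S : ℝ, 0 ≤ S ∧ ∀ (X : Eucl d × Eucl d) (A : ℝ), 0 ≤ A →
      (∀ Y, ‖u (dualPacket g Y)‖ ≤ A * (1 + ‖Y - X‖) ^ N) →
        ‖u (dualPacket g X)‖ ≤ S * m X + D * (1 + R)⁻¹ * A := by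
  have : Countable Γ := by
    have := ZLattice.module_finite ℝ Γ
    have : SecondCountableTopology Γ := inferInstance
    exact TopologicalSpace.separableSpace_iff_countable.1 inferInstance
  obtain ⟨K, Cl, hCl, hlat⟩ := exists_tsum_lattice_le Γ
  set L := (volume : Measure (Eucl d × Eucl d)).integrablePower with hL
  -- Decay budget: N against the growth of the coefficients, L for integration in Y, K for the
  -- lattice sum, and 1 for the gain 1/(1 + R).
  obtain ⟨C, hC, hT⟩ := exists_norm_stft_weylTranspose_le g χ (N + L + K + 1)
  set I := ∫ Y : Eucl d × Eucl d, ((1 + ‖Y‖) ^ L)⁻¹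
  have hI : 0 ≤ I := integral_nonneg fun Y => by positivity
  refine ⟨C * Cl * I, by positivity, fun R hR => ?_⟩
  set q := (eLpNorm g 2 volume).toReal
  set s := (symbolNorm m Γ χ u).toReal
  have hq : 0 ≤ q := ENNReal.toReal_nonneg
  have hs : 0 ≤ s := ENNReal.toReal_nonneg
  refine ⟨q * (s * (Cm * (1 + R) ^ (N + K))) * Cl, by positivity, fun X A hA hAX => ?_⟩
  obtain ⟨hsum, htsum⟩ := hlat X
  set F : Finset Γ := (finite_norm_sub_lattice_le hsum R).toFinset
  have hF : ∀ γ : Γ, γ ∈ F ↔ ‖X - γ‖ ≤ R := fun γ => by simp [F]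
  set T : Γ → 𝓢(Eucl d, ℂ) := fun γ => weylTranspose (translate χ γ) (dualPacket g X) with hTdef
  have hsplit : u (dualPacket g X) = ∑ γ ∈ F, u (T γ) + u (dualPacket g X - ∑ γ ∈ F, T γ) := by
    rw [map_sub, map_sum]
    ring
  have hmX := (hm X).le
  have hnear : ‖∑ γ ∈ F, u (T γ)‖ ≤ q * (s * (Cm * (1 + R) ^ (N + K))) * Cl * m X := by
    calc ‖∑ γ ∈ F, u (T γ)‖
        ≤ ∑ γ ∈ F, q * (s * (Cm * (1 + R) ^ (N + K))) * m X * ((1 + ‖X - γ‖) ^ K)⁻¹ := by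
          refine norm_sum_le_of_le F fun γ hγ => ?_
          refine (norm_apply_weylTranspose_le hm hu γ g X).trans ?_
          have h1 := hmN γ X
          rw [norm_sub_rev] at h1
          have h2 : (1 + ‖X - (γ : Eucl d × Eucl d)‖) ≤ 1 + R := by linarith [(hF γ).1 hγ]
          -- Inserting this factor lets the uniform lattice sum replace a count of the points in the
          -- ball.
          have h3 : (1 : ℝ) ≤ (1 + R) ^ K * ((1 + ‖X - γ‖) ^ K)⁻¹ := by
            rw [← div_eq_mul_inv, one_le_div₀ (by positivity)]
            gcongr
          have h4 : m γ ≤ Cm * (1 + R) ^ N * m X * ((1 + R) ^ K * ((1 + ‖X - γ‖) ^ K)⁻¹) := by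
            refine le_trans ?_ (le_mul_of_one_le_right (by positivity) h3)
            refine h1.trans ?_
            gcongr
          calc q * (s * m γ) ≤
              q * (s * (Cm * (1 + R) ^ N * m X * ((1 + R) ^ K * ((1 + ‖X - γ‖) ^ K)⁻¹))) := by
                gcongr
            _ = _ := by ring
      _ = q * (s * (Cm * (1 + R) ^ (N + K))) * m X * ∑ γ ∈ F, ((1 + ‖X - γ‖) ^ K)⁻¹ := by
          rw [Finset.mul_sum]
      _ ≤ q * (s * (Cm * (1 + R) ^ (N + K))) * m X * Cl := by
          gcongr
          exact (hsum.sum_le_tsum F fun γ _ => by positivity).trans htsum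
      _ = _ := by ring
  have hrest : ∀ Y, ‖stft g (dualPacket g X - ∑ γ ∈ F, T γ) Y‖ ≤
      C * Cl * (1 + R)⁻¹ * ((1 + ‖Y - X‖) ^ (N + L))⁻¹ := by
    intro Y
    have h1 : HasSum (fun γ : Γ => stft g (T γ) Y) (stft g (dualPacket g X) Y) := by
      simp only [stft_apply]
      exact hasSum_integral_weylTranspose_mul hχ (dualPacket g X) (packet g Y)
    classical
    have h2 : HasSum (fun γ : Γ => if γ ∈ F then stft g (T γ) Y else 0)
        (∑ γ ∈ F, stft g (T γ) Y) := by
      rw [← Finset.sum_congr rfl fun γ (hγ : γ ∈ F) => if_pos hγ]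
      exact hasSum_sum_of_ne_finset_zero fun γ hγ => if_neg hγ
    rw [stft_sub_sum]
    have h3 := (hsum.hasSum.mul_left (C * (1 + R)⁻¹ * ((1 + ‖Y - X‖) ^ (N + L))⁻¹))
    refine ((h1.sub h2).norm_le_of_bounded h3 fun γ => ?_).trans ?_
    · by_cases hγ : γ ∈ F
      · rw [if_pos hγ, sub_self, norm_zero]
        positivity
      rw [if_neg hγ, sub_zero]
      refine (hT γ X Y).trans ?_
      have h4 : R ≤ ‖X - γ‖ := (not_le.1 fun h => hγ ((hF γ).2 h)).le
      have h5 := one_add_norm_sub_le Y (γ : Eucl d × Eucl d) X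
      rw [norm_sub_rev (γ : Eucl d × Eucl d) X] at h5
      -- One power of the X - γ decay yields 1/(1 + R), K powers are kept for summation, and N + L
      -- powers combine with the Y - γ decay into decay in Y - X.
      have h6 : ((1 + ‖X - γ‖) ^ (N + L + K + 1))⁻¹ * ((1 + ‖Y - γ‖) ^ (N + L + K + 1))⁻¹ ≤
          (1 + R)⁻¹ * ((1 + ‖Y - X‖) ^ (N + L))⁻¹ * ((1 + ‖X - γ‖) ^ K)⁻¹ := by
        rw [← mul_inv, ← mul_inv, ← mul_inv]
        refine inv_anti₀ (by positivity) ?_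
        calc (1 + R) * (1 + ‖Y - X‖) ^ (N + L) * (1 + ‖X - γ‖) ^ K
            ≤ (1 + ‖X - γ‖) * ((1 + ‖Y - γ‖) * (1 + ‖X - γ‖)) ^ (N + L) *
              (1 + ‖X - γ‖) ^ K := by gcongr
          _ = (1 + ‖X - γ‖) ^ (N + L + K + 1) * (1 + ‖Y - γ‖) ^ (N + L) := by
              rw [mul_pow]
              ring
          _ ≤ (1 + ‖X - γ‖) ^ (N + L + K + 1) * (1 + ‖Y - γ‖) ^ (N + L + K + 1) := by
              refine mul_le_mul_of_nonneg_left (pow_le_pow_right₀ ?_ (by omega)) (by positivity)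
              linarith [norm_nonneg (Y - γ)]
      calc _ = C * (((1 + ‖X - γ‖) ^ (N + L + K + 1))⁻¹ *
            ((1 + ‖Y - γ‖) ^ (N + L + K + 1))⁻¹) := by ring
        _ ≤ C * ((1 + R)⁻¹ * ((1 + ‖Y - X‖) ^ (N + L))⁻¹ * ((1 + ‖X - γ‖) ^ K)⁻¹) := by gcongr
        _ = _ := by ring
    · calc _ ≤ C * (1 + R)⁻¹ * ((1 + ‖Y - X‖) ^ (N + L))⁻¹ * Cl := by gcongr
        _ = _ := by ring
  have hfar : ‖u (dualPacket g X - ∑ γ ∈ F, T γ)‖ ≤ C * Cl * I * (1 + R)⁻¹ * A := by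
    refine (norm_apply_le_integral_stft hg u _).trans ?_
    calc ∫ Y, ‖stft g (dualPacket g X - ∑ γ ∈ F, T γ) Y‖ * ‖u (dualPacket g Y)‖
        ≤ ∫ Y, C * Cl * (1 + R)⁻¹ * A * ((1 + ‖Y - X‖) ^ L)⁻¹ := by
          refine integral_mono_of_nonneg (.of_forall fun Y => by positivity)
            ((integrable_inv_one_add_norm_sub_pow X).const_mul _) (.of_forall fun Y => ?_)
          beta_reduce
          calc _ ≤ C * Cl * (1 + R)⁻¹ * ((1 + ‖Y - X‖) ^ (N + L))⁻¹ *
                (A * (1 + ‖Y - X‖) ^ N) := by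
                  gcongr
                  · exact hrest Y
                  · exact hAX Y
            _ = _ := by
                rw [pow_add]
                field_simp
      _ = C * Cl * (1 + R)⁻¹ * A * I := by
          rw [integral_const_mul, integral_inv_one_add_norm_sub_pow]
      _ = _ := by ring
  rw [hsplit]
  exact (norm_add_le _ _).trans (add_le_add hnear hfar)

end WavePackets
/-! ### Wave packet coefficients: regularity, polynomial growth and control by the order function -/

section Coefficients

variable {d : ℕ}

/-- The phase has temperate growth jointly in x and Y, and slicing does not increase derivative
norms. -/
theorem exists_norm_iteratedFDeriv_dualPhase_le (n : ℕ) :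
    ∃ (M : ℕ) (C : ℝ), 0 ≤ C ∧ ∀ i ≤ n, ∀ (x : Eucl d) (Y : Eucl d × Eucl d),
      ‖iteratedFDeriv ℝ i
        (fun x : Eucl d => Complex.exp ((-inner ℝ x Y.2 : ℝ) * Complex.I)) x‖ ≤
          C * (1 + ‖(x, Y)‖) ^ M := by
  set F : Eucl d × (Eucl d × Eucl d) → ℂ := fun p =>
    Complex.exp ((inner ℝ (ContinuousLinearMap.fst ℝ _ _ p)
        ((-(ContinuousLinearMap.snd ℝ _ _).comp (ContinuousLinearMap.snd ℝ _ _) :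
          Eucl d × (Eucl d × Eucl d) →L[ℝ] Eucl d) p) : ℝ) * Complex.I) with hF
  have hFt : Function.HasTemperateGrowth F := hasTemperateGrowth_cexp_inner _ _
  obtain ⟨M, C, hC, h⟩ := hFt.norm_iteratedFDeriv_le_uniform n
  refine ⟨M, C, hC, fun i hi x Y => ?_⟩
  have h1 : (fun x : Eucl d => Complex.exp ((-inner ℝ x Y.2 : ℝ) * Complex.I)) =
      fun x => F (x, Y) := by
    funext x
    simp [hF]
  rw [h1]
  exact (norm_iteratedFDeriv_slice_le (hFt.1.of_le (mod_cast le_top)) Y x).trans (h i hi (x, Y))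

/-- Powers of x, from the weight and from the phase, are traded for powers of x - y, absorbed by
`g`, and powers of Y. -/
theorem exists_seminorm_dualPacket_le (g : 𝓢(Eucl d, ℂ)) (k n : ℕ) :
    ∃ (M : ℕ) (C : ℝ), 0 ≤ C ∧ ∀ Y, SchwartzMap.seminorm ℂ k n (dualPacket g Y) ≤
      C * (1 + ‖Y‖) ^ M := by
  obtain ⟨M, C, hC, h⟩ := exists_norm_iteratedFDeriv_dualPhase_le (d := d) n
  set B := 2 ^ (k + M) * ((Finset.Iic (k + M, n)).sup
        (fun m => SchwartzMap.seminorm ℝ m.1 m.2) g)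
  have hB : 0 ≤ B := by positivity
  refine ⟨M + (k + M), ∑ i ∈ Finset.range (n + 1), (n.choose i : ℝ) * (C * B), by positivity,
    fun Y => SchwartzMap.seminorm_le_bound ℂ k n _ (by positivity) fun x => ?_⟩
  have h1 : (dualPacket g Y : Eucl d → ℂ) = fun x =>
      Complex.exp ((-inner ℝ x Y.2 : ℝ) * Complex.I) * g (x - Y.1) :=
    funext (dualPacket_apply g Y)
  have h2 : ContDiff ℝ n fun x : Eucl d => Complex.exp ((-inner ℝ x Y.2 : ℝ) * Complex.I) := by
    have : ContDiff ℝ n fun x : Eucl d => -inner ℝ x Y.2 :=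
      (contDiff_id.inner ℝ contDiff_const).neg
    exact ((Complex.ofRealCLM.contDiff.comp this).mul contDiff_const).cexp
  have h3 : ContDiff ℝ n fun x : Eucl d => g (x - Y.1) :=
    (g.smooth n).comp (contDiff_id.sub contDiff_const)
  have hx : 1 + ‖x‖ ≤ (1 + ‖x - Y.1‖) * (1 + ‖Y‖) := by
    have h4 := one_add_norm_sub_le x Y.1 0
    rw [sub_zero, sub_zero] at h4
    refine h4.trans ?_
    gcongr
    exact norm_fst_le Y
  have hxY : 1 + ‖(x, Y)‖ ≤ (1 + ‖x‖) * (1 + ‖Y‖) := by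
    have h0 := norm_nonneg x
    have h0' := norm_nonneg Y
    have h5 : ‖(x, Y)‖ ≤ ‖x‖ + ‖Y‖ := max_le (by linarith) (by linarith)
    nlinarith [mul_nonneg h0 h0']
  rw [h1]
  refine (mul_le_mul_of_nonneg_left (norm_iteratedFDeriv_mul_le h2 h3 x le_rfl)
    (by positivity)).trans ?_
  rw [Finset.mul_sum, Finset.sum_mul]
  refine Finset.sum_le_sum fun i hi => ?_
  have hi' : i ≤ n := Nat.lt_succ_iff.1 (Finset.mem_range.1 hi)
  rw [iteratedFDeriv_comp_sub]
  have h6 := SchwartzMap.one_add_le_sup_seminorm_apply (𝕜 := ℝ) (m := (k + M, n)) (k := k + M)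
    (n := n - i) le_rfl (Nat.sub_le n i) g (x - Y.1)
  set p := ‖iteratedFDeriv ℝ (n - i) g (x - Y.1)‖
  have hp : 0 ≤ p := norm_nonneg _
  calc ‖x‖ ^ k * ((n.choose i : ℝ) * ‖iteratedFDeriv ℝ i
          (fun x : Eucl d => Complex.exp ((-inner ℝ x Y.2 : ℝ) * Complex.I)) x‖ * p)
      ≤ (1 + ‖x‖) ^ k * ((n.choose i : ℝ) * (C * ((1 + ‖x‖) * (1 + ‖Y‖)) ^ M) * p) := by
        gcongr
        · linarith
        · refine (h i hi' x Y).trans ?_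
          gcongr
    _ = (n.choose i : ℝ) * C * (1 + ‖Y‖) ^ M * ((1 + ‖x‖) ^ (k + M) * p) := by
        rw [mul_pow]
        ring
    _ ≤ (n.choose i : ℝ) * C * (1 + ‖Y‖) ^ M *
        (((1 + ‖x - Y.1‖) * (1 + ‖Y‖)) ^ (k + M) * p) := by gcongr
    _ = (n.choose i : ℝ) * C * (1 + ‖Y‖) ^ (M + (k + M)) *
        ((1 + ‖x - Y.1‖) ^ (k + M) * p) := by
        rw [mul_pow]
        ring
    _ ≤ (n.choose i : ℝ) * C * (1 + ‖Y‖) ^ (M + (k + M)) * B := by gcongr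
    _ = _ := by ring

theorem exists_norm_apply_dualPacket_le_pow (u : 𝓢'(Eucl d, ℂ)) (g : 𝓢(Eucl d, ℂ)) :
    ∃ (M : ℕ) (B : ℝ), 0 ≤ B ∧ ∀ Y, ‖u (dualPacket g Y)‖ ≤ B * (1 + ‖Y‖) ^ M := by
  obtain ⟨s, A, hA, h⟩ := exists_seminorm_bound u
  choose M C hC hCM using fun i : ℕ × ℕ => exists_seminorm_dualPacket_le g i.1 i.2
  have h0 : 0 ≤ ∑ i ∈ s, C i := Finset.sum_nonneg fun i _ => hC i
  refine ⟨s.sup M, A * ∑ i ∈ s, C i, by positivity, fun Y => ?_⟩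
  rw [mul_assoc]
  refine h _ _ (by positivity) fun i hi => (hCM i Y).trans ?_
  gcongr
  · exact Finset.single_le_sum (fun i _ => hC i) hi
  · linarith [norm_nonneg Y]
  · exact Finset.le_sup hi

theorem exists_schwartz_eventually_eq_one {V : Type} [NormedAddCommGroup V] [NormedSpace ℝ V]
    [FiniteDimensional ℝ V] (c : V) :
    ∃ h : 𝓢(V, ℂ), (∀ᶠ x in 𝓝 c, h x = 1) ∧ ∀ x, ((‖h x‖ : ℝ) : ℂ) = h x := by
  let φ : ContDiffBump c := default
  have h1 : HasCompactSupport (Complex.ofRealCLM ∘ φ) := φ.hasCompactSupport.comp_left rfl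
  have h2 : ContDiff ℝ ∞ (Complex.ofRealCLM ∘ φ) := Complex.ofRealCLM.contDiff.comp φ.contDiff
  refine ⟨h1.toSchwartzMap h2, φ.eventuallyEq_one.mono fun x hx => ?_, fun x => ?_⟩
  · change ((φ x : ℝ) : ℂ) = 1
    rw [hx]
    simp
  · change ((‖((φ x : ℝ) : ℂ)‖ : ℝ) : ℂ) = ((φ x : ℝ) : ℂ)
    rw [Complex.norm_real, Real.norm_of_nonneg φ.nonneg]

/-- Continuity is local: a cutoff equal to 1 near the given point turns the packets into slices of a
Schwartz function. -/
theorem continuous_apply_dualPacket (u : 𝓢'(Eucl d, ℂ)) (g : 𝓢(Eucl d, ℂ)) :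
    Continuous fun Y => u (dualPacket g Y) := by
  refine continuous_iff_continuousAt.2 fun Y₀ => ?_
  obtain ⟨h, h1, -⟩ := exists_schwartz_eventually_eq_one Y₀
  refine (continuous_apply_slice u (packetFamily g h)).continuousAt.congr (h1.mono fun Y hY => ?_)
  beta_reduce
  rw [apply_slice_packetFamily, hY, one_mul]

theorem exists_schwartz_integral_mul_self_eq_one (d : ℕ) :
    ∃ g : 𝓢(Eucl d, ℂ), ∫ x, g x * g x = 1 := by
  obtain ⟨h, h1, h2⟩ := exists_schwartz_eventually_eq_one (0 : Eucl d)
  have h3 : ∀ x, h x * h x = ((‖h x‖ * ‖h x‖ : ℝ) : ℂ) := fun x => by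
    rw [Complex.ofReal_mul, h2]
  have h4 : 0 < ∫ x, ‖h x‖ * ‖h x‖ := by
    have hc : Continuous fun x => ‖h x‖ * ‖h x‖ := by fun_prop
    have hi : Integrable fun x => ‖h x‖ * ‖h x‖ := by
      simpa only [norm_mul] using (integrable_mul_schwartz h h).norm
    refine integral_pos_of_integrable_nonneg_nonzero hc hi (fun x => by positivity) (x := 0) ?_
    rw [h1.self_of_nhds]
    simp
  refine ⟨((Real.sqrt (∫ x, ‖h x‖ * ‖h x‖) : ℝ) : ℂ)⁻¹ • h, ?_⟩
  have h5 : ∀ a b : ℂ, (a * b) * (a * b) = (a * a) * (b * b) := fun a b => by ring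
  simp only [smul_apply, smul_eq_mul]
  simp only [h5 (_ : ℂ)⁻¹]
  rw [integral_const_mul, integral_congr_ae (.of_forall h3), integral_complex_ofReal, ← mul_inv,
    ← Complex.ofReal_mul, Real.mul_self_sqrt h4.le]
  exact inv_mul_cancel₀ (by exact_mod_cast h4.ne')

/-- Temperedness gives polynomial growth of the coefficients, and absorption upgrades it to control
by `m`. Both inputs are first brought to the common exponent `max N M`. -/
theorem exists_norm_apply_dualPacket_le {m : Eucl d × Eucl d → ℝ} (hm : IsOrderFunction m)
    {Γ : Submodule ℤ (Eucl d × Eucl d)} [DiscreteTopology Γ] [IsZLattice ℝ Γ]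
    {χ : 𝓢(Eucl d × Eucl d, ℝ)} (hχ : IsLatticePartition Γ χ) {u : 𝓢'(Eucl d, ℂ)}
    (hu : u ∈ symbolSpace m Γ χ) {g : 𝓢(Eucl d, ℂ)} (hg : ∫ x, g x * g x = 1) :
    ∃ S : ℝ, 0 ≤ S ∧ ∀ X, ‖u (dualPacket g X)‖ ≤ S * m X := by
  obtain ⟨C, N, hC, hN⟩ := hm.exists_le
  obtain ⟨M, B, hB, hM⟩ := exists_norm_apply_dualPacket_le_pow u g
  have hN' : ∀ X Y, m X ≤ C * (1 + ‖X - Y‖) ^ (max N M) * m Y := fun X Y => by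
    have := (hm.pos Y).le
    refine (hN X Y).trans ?_
    gcongr
    · linarith [norm_nonneg (X - Y)]
    · exact le_max_left _ _
  have hM' : ∀ X, ‖u (dualPacket g X)‖ ≤ B * (1 + ‖X‖) ^ (max N M) := fun X => by
    refine (hM X).trans ?_
    gcongr
    · linarith [norm_nonneg X]
    · exact le_max_right _ _
  obtain ⟨D, hD, h⟩ := exists_norm_apply_dualPacket_absorption hχ hm.pos hu hg hC hN'
  exact exists_le_mul_of_absorption hm.pos hC hN' (fun X => norm_nonneg _) hM' hD h

end Coefficients
/-! ### Bounded wave packet coefficients bound the symbol norm -/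

section Approximation

variable {d : ℕ}

theorem eLpNorm_two_inv_one_add_norm_pow_ne_top (d : ℕ) :
    eLpNorm (fun x : Eucl d => ((1 + ‖x‖) ^ (volume : Measure (Eucl d)).integrablePower)⁻¹) 2
      volume ≠ ⊤ := by
  have h := integrable_inv_one_add_norm_pow (Eucl d)
  refine ((memLp_two_iff_integrable_sq h.aestronglyMeasurable).2
    (h.mono' (h.aestronglyMeasurable.pow 2) (.of_forall fun x => ?_))).eLpNorm_ne_top
  rw [Real.norm_of_nonneg (by positivity)]
  exact pow_le_of_le_one (by positivity)
    (inv_le_one_of_one_le₀ (one_le_pow₀ (by linarith [norm_nonneg x]))) two_ne_zero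

/-- Expand the kernel K(x, ·) by the reproducing formula. Its decay in Y - γ moves m(Y) to m(γ) and
permits integration in Y, leaving decay in x away from the base point of γ. -/
theorem exists_norm_weylApply_le {m : Eucl d × Eucl d → ℝ} (hm : IsOrderFunction m)
    (χ : 𝓢(Eucl d × Eucl d, ℝ)) {g : 𝓢(Eucl d, ℂ)} (hg : ∫ x, g x * g x = 1) (J : ℕ) :
    ∃ C : ℝ, 0 ≤ C ∧ ∀ (v : 𝓢'(Eucl d, ℂ)) (A : ℝ), 0 ≤ A →
      (∀ Y, ‖v (dualPacket g Y)‖ ≤ A * m Y) → ∀ γ x,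
        ‖weylApply (translate χ γ) v x‖ ≤ C * A * m γ * ((1 + ‖x - γ.1‖) ^ J)⁻¹ := by
  obtain ⟨Cm, N, hCm, hN⟩ := hm.exists_le
  set L := (volume : Measure (Eucl d × Eucl d)).integrablePower
  obtain ⟨C, hC, hK⟩ := exists_norm_stft_weylKernel_le g χ (N + L + J)
  set I := ∫ Y : Eucl d × Eucl d, ((1 + ‖Y‖) ^ L)⁻¹
  have hI : 0 ≤ I := integral_nonneg fun Y => by positivity
  refine ⟨C * Cm * I, by positivity, fun v A hA hv γ x => ?_⟩
  have hγ := (hm.pos γ).le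
  refine (norm_apply_le_integral_stft hg v _).trans ?_
  calc ∫ Y, ‖stft g (weylKernel (translate χ γ) x) Y‖ * ‖v (dualPacket g Y)‖
      ≤ ∫ Y, C * Cm * A * m γ * ((1 + ‖x - γ.1‖) ^ J)⁻¹ * ((1 + ‖Y - γ‖) ^ L)⁻¹ := by
        refine integral_mono_of_nonneg (.of_forall fun Y => by positivity)
          ((integrable_inv_one_add_norm_sub_pow γ).const_mul _) (.of_forall fun Y => ?_)
        have hx : 1 ≤ 1 + ‖x - γ.1‖ := by linarith [norm_nonneg (x - γ.1)]
        have hY : 1 ≤ 1 + ‖Y - γ‖ := by linarith [norm_nonneg (Y - γ)]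
        calc ‖stft g (weylKernel (translate χ γ) x) Y‖ * ‖v (dualPacket g Y)‖
            ≤ C * ((1 + ‖x - γ.1‖) ^ (N + L + J))⁻¹ * ((1 + ‖Y - γ‖) ^ (N + L + J))⁻¹ *
              (A * (Cm * (1 + ‖Y - γ‖) ^ N * m γ)) := by
              gcongr
              · exact hK γ Y x
              · exact (hv Y).trans (mul_le_mul_of_nonneg_left (hN Y γ) hA)
          _ ≤ C * ((1 + ‖x - γ.1‖) ^ J)⁻¹ * ((1 + ‖Y - γ‖) ^ (N + L))⁻¹ *
              (A * (Cm * (1 + ‖Y - γ‖) ^ N * m γ)) := by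
              have h1 := pow_le_pow_right₀ hx (Nat.le_add_left J (N + L))
              have h2 := pow_le_pow_right₀ hY (Nat.le_add_right (N + L) J)
              gcongr ?_ * _
              exact mul_le_mul (mul_le_mul_of_nonneg_left (inv_anti₀ (by positivity) h1) hC)
                (inv_anti₀ (by positivity) h2) (by positivity) (by positivity)
          _ = _ := by
              rw [pow_add]
              field_simp
    _ = C * Cm * A * m γ * ((1 + ‖x - γ.1‖) ^ J)⁻¹ * I := by
        rw [integral_const_mul, integral_inv_one_add_norm_sub_pow]
    _ = _ := by ring

theorem exists_symbolNorm_le {m : Eucl d × Eucl d → ℝ} (hm : IsOrderFunction m)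
    (Γ : Submodule ℤ (Eucl d × Eucl d)) (χ : 𝓢(Eucl d × Eucl d, ℝ)) {g : 𝓢(Eucl d, ℂ)}
    (hg : ∫ x, g x * g x = 1) :
    ∃ C : ℝ, 0 ≤ C ∧ ∀ (v : 𝓢'(Eucl d, ℂ)) (A : ℝ), 0 ≤ A →
      (∀ Y, ‖v (dualPacket g Y)‖ ≤ A * m Y) → symbolNorm m Γ χ v ≤ ENNReal.ofReal (C * A) := by
  set J := (volume : Measure (Eucl d)).integrablePower
  obtain ⟨C, hC, h⟩ := exists_norm_weylApply_le hm χ hg J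
  have hw := eLpNorm_two_inv_one_add_norm_pow_ne_top d
  set w : Eucl d → ℝ := fun x => ((1 + ‖x‖) ^ J)⁻¹
  have hwm : AEStronglyMeasurable w volume :=
    (integrable_inv_one_add_norm_pow (Eucl d)).aestronglyMeasurable
  refine ⟨C * (eLpNorm w 2 volume).toReal, by positivity, fun v A hA hv => iSup_le fun γ => ?_⟩
  have hγ := (hm.pos γ).le
  refine ENNReal.div_le_of_le_mul ?_
  calc eLpNorm (weylApply (translate χ γ) v) 2 volume
      ≤ eLpNorm ((C * A * m γ) • fun x => w (x - (γ : Eucl d × Eucl d).1)) 2 volume :=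
        eLpNorm_mono_real fun x => h v A hA hv γ x
    _ = ENNReal.ofReal (C * A * m γ) * ENNReal.ofReal (eLpNorm w 2 volume).toReal := by
        rw [eLpNorm_const_smul, eLpNorm_comp_sub_right hwm,
          Real.enorm_of_nonneg (by positivity), ENNReal.ofReal_toReal hw]
    _ = _ := by
        rw [← ENNReal.ofReal_mul (by positivity), ← ENNReal.ofReal_mul (by positivity)]
        congr 1
        ring

/-! ### Discretized wave packet expansions -/

/-- The superposition of the wave packets at the values of the simple function `s`, with
coefficients `Φ` and weighted by the measure `μ`. -/
noncomputable def packetSum (g : 𝓢(Eucl d, ℂ)) (Φ : Eucl d × Eucl d → ℂ)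
    (s : SimpleFunc (Eucl d × Eucl d) (Eucl d × Eucl d)) (μ : Measure (Eucl d × Eucl d)) :
    𝓢(Eucl d, ℂ) :=
  (((2 * Real.pi) ^ d : ℝ) : ℂ)⁻¹ • ∑ Y ∈ s.range, (μ.real (s ⁻¹' {Y}) • Φ Y) • packet g Y

theorem _root_.MeasureTheory.SimpleFunc.integral_comp_eq_sum {α β : Type} [MeasurableSpace α]
    (s : SimpleFunc α β) (μ : Measure α) [IsFiniteMeasure μ] (H : β → ℂ) :
    ∫ Y, H (s Y) ∂μ = ∑ y ∈ s.range, μ.real (s ⁻¹' {y}) • H y := by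
  have h1 : ∀ Y, H (s Y) = ∑ y ∈ s.range, (s ⁻¹' {y}).indicator (fun _ => H y) Y := by
    intro Y
    rw [Finset.sum_eq_single_of_mem (s Y) (s.mem_range_self Y)]
    · rw [Set.indicator_of_mem (by rfl)]
    · intro y _ hy
      exact Set.indicator_of_notMem (fun h => hy (Eq.symm h)) _
  simp only [h1]
  rw [integral_finsetSum _ fun y _ =>
    (integrable_const (H y)).indicator (s.measurableSet_preimage {y})]
  exact Finset.sum_congr rfl fun y _ => integral_indicator_const _ (s.measurableSet_preimage {y})

/-- Against a test function, the finite packet sum is the integral of the reproducing formula with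
its integrand sampled at s(Y). Limits of packet sums thus become limits of integrals. -/
theorem toTemperedDistribution_packetSum (g : 𝓢(Eucl d, ℂ)) (Φ : Eucl d × Eucl d → ℂ)
    (s : SimpleFunc (Eucl d × Eucl d) (Eucl d × Eucl d)) (μ : Measure (Eucl d × Eucl d))
    [IsFiniteMeasure μ] (f : 𝓢(Eucl d, ℂ)) :
    SchwartzMap.toTemperedDistributionCLM (Eucl d) ℂ volume (packetSum g Φ s μ) f =
      (((2 * Real.pi) ^ d : ℝ) : ℂ)⁻¹ * ∫ Y, stft g f (s Y) * Φ (s Y) ∂μ := by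
  rw [s.integral_comp_eq_sum μ fun Y => stft g f Y * Φ Y]
  simp only [SchwartzMap.toTemperedDistributionCLM_apply_apply]
  have h1 : ∀ x, f x • packetSum g Φ s μ x = (((2 * Real.pi) ^ d : ℝ) : ℂ)⁻¹ *
      ∑ Y ∈ s.range, (μ.real (s ⁻¹' {Y}) • Φ Y) * (f x * packet g Y x) := by
    intro x
    simp only [packetSum, smul_apply, sum_apply, smul_eq_mul, Finset.mul_sum]
    exact Finset.sum_congr rfl fun Y _ => by ring
  simp only [h1]
  rw [integral_const_mul, integral_finsetSum _ fun Y _ =>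
    (integrable_mul_schwartz f (packet g Y)).const_mul _]
  congr 1
  refine Finset.sum_congr rfl fun Y _ => ?_
  rw [integral_const_mul, ← stft_apply, smul_mul_assoc, mul_comm (Φ Y)]

/-- Simple functions approximating the identity of phase space. -/
noncomputable def phaseGrid (d n : ℕ) : SimpleFunc (Eucl d × Eucl d) (Eucl d × Eucl d) :=
  SimpleFunc.approxOn id measurable_id Set.univ 0 (Set.mem_univ _) n

theorem tendsto_phaseGrid (Y : Eucl d × Eucl d) :
    Tendsto (fun n => phaseGrid d n Y) atTop (𝓝 Y) :=
  SimpleFunc.tendsto_approxOn measurable_id (Set.mem_univ _) (by simp)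

/-- The part of the ball of radius `n` on which `phaseGrid d n` moves points by at most `1`. -/
def gridDomain (d n : ℕ) : Set (Eucl d × Eucl d) :=
  Metric.ball 0 n ∩ {Y | ‖phaseGrid d n Y - Y‖ ≤ 1}

theorem measurableSet_gridDomain (d n : ℕ) : MeasurableSet (gridDomain d n) :=
  Metric.isOpen_ball.measurableSet.inter
    (measurableSet_le ((phaseGrid d n).measurable.sub measurable_id).norm measurable_const)

instance (d n : ℕ) : IsFiniteMeasure (volume.restrict (gridDomain d n)) :=
  isFiniteMeasure_restrict.2 ((measure_mono Set.inter_subset_left).trans_lt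
    (measure_ball_lt_top (x := (0 : Eucl d × Eucl d)) (r := n))).ne

theorem eventually_mem_gridDomain (Y : Eucl d × Eucl d) : ∀ᶠ n in atTop, Y ∈ gridDomain d n := by
  have h1 : ∀ᶠ n : ℕ in atTop, ‖Y‖ < n :=
    tendsto_natCast_atTop_atTop.eventually_gt_atTop ‖Y‖
  have h2 : Tendsto (fun n => ‖phaseGrid d n Y - Y‖) atTop (𝓝 ‖Y - Y‖) :=
    ((tendsto_phaseGrid Y).sub_const Y).norm
  rw [sub_self, norm_zero] at h2
  filter_upwards [h1, h2.eventually_le_const one_pos] with n hn hn'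
  exact ⟨by simpa using hn, hn'⟩

/-- The sample point lies within distance 1 of Y, so weights at the two points differ by at most
2^L. The resulting majorant does not depend on n and serves both the convergence and the uniform
bound. -/
theorem norm_mul_comp_phaseGrid_le {m : Eucl d × Eucl d → ℝ} {Φ F : Eucl d × Eucl d → ℂ}
    {Cm S C : ℝ} {N L n : ℕ} {X : Eucl d × Eucl d} (hCm : 0 ≤ Cm) (hS : 0 ≤ S) (hC : 0 ≤ C)
    (hmX : 0 ≤ m X) (hm : ∀ X Y, m X ≤ Cm * (1 + ‖X - Y‖) ^ N * m Y) (hΦ : ∀ Y, ‖Φ Y‖ ≤ S * m Y)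
    (hF : ∀ Y, ‖F Y‖ ≤ C * ((1 + ‖Y - X‖) ^ (N + L))⁻¹) {Y : Eucl d × Eucl d}
    (hY : Y ∈ gridDomain d n) :
    ‖F (phaseGrid d n Y) * Φ (phaseGrid d n Y)‖ ≤
      S * Cm * C * 2 ^ L * m X * ((1 + ‖Y - X‖) ^ L)⁻¹ := by
  set Z := phaseGrid d n Y
  have hZ : ‖Y - Z‖ ≤ 1 := by
    rw [norm_sub_rev]
    exact hY.2
  have h1 : 1 + ‖Y - X‖ ≤ 2 * (1 + ‖Z - X‖) := by
    refine (one_add_norm_sub_le Y Z X).trans ?_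
    gcongr
    linarith
  have h2 : ((1 + ‖Z - X‖) ^ L)⁻¹ ≤ 2 ^ L * ((1 + ‖Y - X‖) ^ L)⁻¹ := by
    rw [← div_eq_mul_inv, le_div_iff₀ (by positivity), inv_mul_le_iff₀ (by positivity), mul_comm,
      ← mul_pow]
    gcongr
  rw [norm_mul]
  calc ‖F Z‖ * ‖Φ Z‖
      ≤ C * ((1 + ‖Z - X‖) ^ (N + L))⁻¹ * (S * (Cm * (1 + ‖Z - X‖) ^ N * m X)) := by
        gcongr
        · exact hF Z
        · exact (hΦ Z).trans (mul_le_mul_of_nonneg_left (hm Z X) hS)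
    _ = S * Cm * C * m X * ((1 + ‖Z - X‖) ^ L)⁻¹ := by
        rw [pow_add]
        field_simp
    _ ≤ S * Cm * C * m X * (2 ^ L * ((1 + ‖Y - X‖) ^ L)⁻¹) := by gcongr
    _ = _ := by ring

end Approximation
-- Convergence and uniform coefficient bounds for the Riemann sums
section Convergence

variable {d : ℕ}

theorem tendsto_packetSum {m : Eucl d × Eucl d → ℝ} (hm : IsOrderFunction m)
    {u : 𝓢'(Eucl d, ℂ)} {g : 𝓢(Eucl d, ℂ)} (hg : ∫ x, g x * g x = 1) {S : ℝ} (hS : 0 ≤ S)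
    (hu : ∀ Y, ‖u (dualPacket g Y)‖ ≤ S * m Y) :
    Tendsto (fun n => SchwartzMap.toTemperedDistributionCLM (Eucl d) ℂ volume
      (packetSum g (fun Y => u (dualPacket g Y)) (phaseGrid d n)
        (volume.restrict (gridDomain d n)))) atTop (𝓝 u) := by
  obtain ⟨Cm, N, hCm, hN⟩ := hm.exists_le
  -- Convergence is tested on each Schwartz function, where dominated convergence applies with the
  -- majorant centred at X = 0.
  refine PointwiseConvergenceCLM.tendsto_iff_forall_tendsto.2 fun f => ?_
  set L := (volume : Measure (Eucl d × Eucl d)).integrablePower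
  obtain ⟨C, hC, hF⟩ := exists_norm_le_inv_pow (stft g f) (N + L)
  simp only [toTemperedDistribution_packetSum]
  rw [apply_eq_integral_stft hg u f]
  refine Tendsto.const_mul _ ?_
  have h1 : ∀ n, ∫ Y in gridDomain d n,
      stft g f (phaseGrid d n Y) * u (dualPacket g (phaseGrid d n Y)) =
      ∫ Y, (gridDomain d n).indicator
        (fun Y => stft g f (phaseGrid d n Y) * u (dualPacket g (phaseGrid d n Y))) Y := fun n =>
    (integral_indicator (measurableSet_gridDomain d n)).symm
  have hcont : Continuous fun Y => stft g f Y * u (dualPacket g Y) :=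
    (stft g f).continuous.mul (continuous_apply_dualPacket u g)
  have hm0 := (hm.pos 0).le
  simp only [h1]
  refine tendsto_integral_of_dominated_convergence
    (fun Y => S * Cm * C * 2 ^ L * m 0 * ((1 + ‖Y - 0‖) ^ L)⁻¹) (fun n => ?_)
    ((integrable_inv_one_add_norm_sub_pow 0).const_mul _) (fun n => .of_forall fun Y => ?_)
    (.of_forall fun Y => ?_)
  · exact (hcont.measurable.comp (phaseGrid d n).measurable).aestronglyMeasurable.indicator
      (measurableSet_gridDomain d n)
  · by_cases hY : Y ∈ gridDomain d n
    · rw [Set.indicator_of_mem hY]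
      refine norm_mul_comp_phaseGrid_le (F := stft g f) (Φ := fun Y => u (dualPacket g Y))
        (zero_le_one.trans hCm) hS hC hm0 hN hu (fun Y => ?_) hY
      rw [sub_zero]
      exact hF Y
    · rw [Set.indicator_of_notMem hY, norm_zero]
      positivity
  · refine ((hcont.tendsto Y).comp (tendsto_phaseGrid Y)).congr' ?_
    filter_upwards [eventually_mem_gridDomain Y] with n hn
    rw [Set.indicator_of_mem hn]
    rfl

/-- The coefficient at X is a sampled integral of Φ against a kernel decaying rapidly in Y - X; this
decay moves m(Y) to m(X), uniformly in the discretization. -/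
theorem exists_norm_packetSum_dualPacket_le {m : Eucl d × Eucl d → ℝ} (hm : IsOrderFunction m)
    (g : 𝓢(Eucl d, ℂ)) {Φ : Eucl d × Eucl d → ℂ} {S : ℝ} (hS : 0 ≤ S)
    (hΦ : ∀ Y, ‖Φ Y‖ ≤ S * m Y) :
    ∃ A : ℝ, 0 ≤ A ∧ ∀ n X, ‖SchwartzMap.toTemperedDistributionCLM (Eucl d) ℂ volume
      (packetSum g Φ (phaseGrid d n) (volume.restrict (gridDomain d n))) (dualPacket g X)‖ ≤
        A * m X := by
  obtain ⟨Cm, N, hCm, hN⟩ := hm.exists_le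
  set L := (volume : Measure (Eucl d × Eucl d)).integrablePower
  obtain ⟨C, hC, hF⟩ := exists_norm_le_inv_pow (stft g g) (N + L)
  set I := ∫ Y : Eucl d × Eucl d, ((1 + ‖Y‖) ^ L)⁻¹
  have hI : 0 ≤ I := integral_nonneg fun Y => by positivity
  set c := ‖(((2 * Real.pi) ^ d : ℝ) : ℂ)⁻¹‖
  refine ⟨c * (S * Cm * C * 2 ^ L * I), by positivity, fun n X => ?_⟩
  have hmX := (hm.pos X).le
  have hint : Integrable fun Y : Eucl d × Eucl d =>
      S * Cm * C * 2 ^ L * m X * ((1 + ‖Y - X‖) ^ L)⁻¹ :=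
    (integrable_inv_one_add_norm_sub_pow X).const_mul _
  rw [toTemperedDistribution_packetSum, norm_mul, mul_assoc c]
  refine mul_le_mul_of_nonneg_left ?_ (norm_nonneg _)
  calc ‖∫ Y in gridDomain d n, stft g (dualPacket g X) (phaseGrid d n Y) * Φ (phaseGrid d n Y)‖
      ≤ ∫ Y in gridDomain d n, S * Cm * C * 2 ^ L * m X * ((1 + ‖Y - X‖) ^ L)⁻¹ := by
        refine norm_integral_le_of_norm_le hint.integrableOn
          ((ae_restrict_iff' (measurableSet_gridDomain d n)).2 (.of_forall fun Y hY => ?_))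
        refine norm_mul_comp_phaseGrid_le (F := stft g (dualPacket g X))
          (zero_le_one.trans hCm) hS hC hmX hN hΦ (fun Y => ?_) hY
        rw [norm_stft_dualPacket]
        exact hF _
    _ ≤ ∫ Y, S * Cm * C * 2 ^ L * m X * ((1 + ‖Y - X‖) ^ L)⁻¹ :=
        setIntegral_le_integral hint (.of_forall fun Y => by positivity)
    _ = S * Cm * C * 2 ^ L * m X * I := by
        rw [integral_const_mul, integral_inv_one_add_norm_sub_pow]
    _ = _ := by ring

end Convergence
end SymbolSpace

/-! ### The approximation theorem -/

theorem proposition2p1 (d : ℕ)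
    (m : SymbolSpace.Eucl d × SymbolSpace.Eucl d → ℝ) (hm : SymbolSpace.IsOrderFunction m)
    (Γ : Submodule ℤ (SymbolSpace.Eucl d × SymbolSpace.Eucl d))
    [DiscreteTopology Γ] [IsZLattice ℝ Γ]
    (χ : 𝓢(SymbolSpace.Eucl d × SymbolSpace.Eucl d, ℝ))
    (hχ : SymbolSpace.IsLatticePartition Γ χ)
    (u : 𝓢'(SymbolSpace.Eucl d, ℂ)) (hu : u ∈ SymbolSpace.symbolSpace m Γ χ) :
    ∃ v : ℕ → 𝓢(SymbolSpace.Eucl d, ℂ),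
      Tendsto (fun ν => SchwartzMap.toTemperedDistributionCLM (SymbolSpace.Eucl d) ℂ volume (v ν))
        atTop (𝓝 u) ∧
      (∀ ν, SchwartzMap.toTemperedDistributionCLM (SymbolSpace.Eucl d) ℂ volume (v ν) ∈
        SymbolSpace.symbolSpace m Γ χ) ∧
      ∃ C : ℝ, ∀ ν, SymbolSpace.symbolNorm m Γ χ
        (SchwartzMap.toTemperedDistributionCLM (SymbolSpace.Eucl d) ℂ volume (v ν)) ≤
          ENNReal.ofReal C := by
  obtain ⟨g, hg⟩ := SymbolSpace.exists_schwartz_integral_mul_self_eq_one d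
  obtain ⟨S, hS, huS⟩ := SymbolSpace.exists_norm_apply_dualPacket_le hm hχ hu hg
  obtain ⟨A, hA, hvA⟩ := SymbolSpace.exists_norm_packetSum_dualPacket_le hm g hS huS
  obtain ⟨C, -, hC⟩ := SymbolSpace.exists_symbolNorm_le hm Γ χ hg
  have h := fun ν => hC _ A hA (hvA ν)
  exact ⟨_, SymbolSpace.tendsto_packetSum hm hg hS huS,
    fun ν => (h ν).trans_lt ENNReal.ofReal_lt_top, C * A, h⟩
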